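/- Let $\kappa$ be a regular uncountable cardinal and let $\lambda$ be a singular cardinal with $\mathrm{cf}(\lambda)\ge\kappa$. For cardinals $\rho$ and sets $S$ put $P_\rho(S)=\{a\subseteq S:|a|<\rho\}$. For a cardinal $\tau\ge\kappa$, an ideal on $P_\kappa(\tau)$ is a proper family $J$ of subsets of $P_\kappa(\tau)$, closed under subsets and under unions of fewer than $\kappa$ members, that contains every $A\subseteq P_\kappa(\tau)$ which is not $\subseteq$-cofinal in $P_\kappa(\tau)$; $J^+$ is the family of subsets of $P_\kappa(\tau)$ not in $J$, and for $A\in J^+$, $J|A=\{B\subseteq P_\kappa(\tau):B\cap A\in J\}$. For a cardinal $2\le\theta\le\kappa$, $J$ is $[\tau]^{<\theta}$-normal if for every $A\in J^+$ and every function $f$ on $A$ with $f(a)\in P_{|a\cap\theta|}(a)$ for all $a\in A$, $f$ is constant on some $B\in J^+$ with $B\subseteq A$. If such ideals exist, $NS_{\kappa,\tau}^{[\tau]^{<\theta}}$ denotes the smallest one. $NS_{\kappa,\tau}$ is the ideal of nonstationary subsets of $P_\kappa(\tau)$ (those disjoint from some closed unbounded set). $\overline{\mathrm{cof}}(J)$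 is the least size of a $Y\subseteq J$ such that every member of $J$ is covered by the union of fewer than $\kappa$ members of $Y$. Put $\overline\theta=\nu$ if $\theta=\kappa=\nu^+$, and $\overline\theta=\theta$ otherwise. Let $M_J$ be the collection of all $Q\subseteq J^+$ such that $A\cap B\in J$ for distinct $A,B\in Q$ and every $C\in J^+$ has $A\cap C\in J^+$ for some $A\in Q$. $J$ is precipitous if for every $A\in J^+$ and all $Q_n\in M_{J|A}$ $(n<\omega)$ such that each member of $Q_{n+1}$ is included in a member of $Q_n$, there are $f(n)\in Q_n$ with $f(0)\supseteq f(1)\supseteq\cdots$ and $\bigcap_{n<\omega}f(n)\ne\emptyset$. $J$ is nowhere precipitous if $J|A$ is not precipitous for any $A\in J^+$. (1) Let $\theta$ be a cardinal with $2\le\theta\le\kappa$ such that there is a $[\lambda]^{<\theta}$-normal ideal on $P_\kappa(\lambda)$ (it then follows that there is a $[\tau]^{<\theta}$-normal ideal on $P_\kappa(\tau)$ for every cardinal $\tau$ with $\kappa\le\tau<\lambda$). Suppose that for every cardinal $\tau$ with $\kappa\le\tau<\lambda$ we have $\tau^{\mathrm{cf}(\lambda)}<\lambda$ and $\overline{\mathrm{cof}}(NS_{\kappa,\tau}^{[\tau]^{<\theta}})\le\lambda^{<\overline\theta}$.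 Then $NS_{\kappa,\lambda}^{[\lambda]^{<\theta}}$ is nowhere precipitous. (2) In particular, if $\lambda$ is a strong limit cardinal, then $NS_{\kappa,\lambda}$ is nowhere precipitous. -/

import Mathlib

open Cardinal Ordinal Set

universe u

namespace PKappaLambda

/-- `P_ρ(S)`: the subsets of `S` of cardinality `< ρ`.  Cardinals are identified with initial
ordinals, and an ordinal with the set of smaller ordinals; sets of ordinals of universe `u` live
one universe higher, whence the lifts below. -/
def smallSubsets (ρ : Cardinal.{u + 1}) (S : Set Ordinal.{u}) : Set (Set Ordinal.{u}) :=
  {a | a ⊆ S ∧ #a < ρ}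

/-- `P_κ(λ)`. -/
def PK (κ lam : Cardinal.{u}) : Set (Set Ordinal.{u}) :=
  smallSubsets (Cardinal.lift.{u + 1} κ) (Iio lam.ord)

/-- `I_{κ,λ}`: the noncofinal subsets of `P_κ(λ)`. -/
def noncofinal (κ lam : Cardinal.{u}) : Set (Set (Set Ordinal.{u})) :=
  {A | A ⊆ PK κ lam ∧ ∃ b ∈ PK κ lam, {a ∈ A | b ⊆ a} = ∅}

/-- `J` is a (proper, `κ`-complete, fine) ideal on `P_κ(λ)`. -/
structure IsIdealOn (κ lam : Cardinal.{u}) (J : Set (Set (Set Ordinal.{u}))) : Prop where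
  subset_PK : ∀ A ∈ J, A ⊆ PK κ lam
  noncofinal_subset : noncofinal κ lam ⊆ J
  PK_notMem : PK κ lam ∉ J
  downward : ∀ A ∈ J, ∀ B, B ⊆ A → B ∈ J
  sUnion_mem : ∀ X, X ⊆ J → #X < Cardinal.lift.{u + 1} κ → ⋃₀ X ∈ J

/-- `J⁺`, the `J`-positive subsets of `P_κ(λ)`. -/
def positive (κ lam : Cardinal.{u}) (J : Set (Set (Set Ordinal.{u}))) :
    Set (Set (Set Ordinal.{u})) :=
  {A | A ⊆ PK κ lam ∧ A ∉ J}

/-- `J ∣ A`. -/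
def restrict (κ lam : Cardinal.{u}) (J : Set (Set (Set Ordinal.{u})))
    (A : Set (Set Ordinal.{u})) : Set (Set (Set Ordinal.{u})) :=
  {B | B ⊆ PK κ lam ∧ B ∩ A ∈ J}

/-- `Q ∈ M_J`: `Q` is a maximal family of pairwise `J`-almost disjoint `J`-positive sets. -/
structure IsMaxAlmostDisjoint (κ lam : Cardinal.{u}) (J : Set (Set (Set Ordinal.{u})))
    (Q : Set (Set (Set Ordinal.{u}))) : Prop where
  subset_positive : Q ⊆ positive κ lam J
  inter_mem : ∀ A ∈ Q, ∀ B ∈ Q, A ≠ B → A ∩ B ∈ J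
  maximal : ∀ C ∈ positive κ lam J, ∃ A ∈ Q, A ∩ C ∈ positive κ lam J

def IsPrecipitous (κ lam : Cardinal.{u}) (J : Set (Set (Set Ordinal.{u}))) : Prop :=
  ∀ A ∈ positive κ lam J, ∀ Q : ℕ → Set (Set (Set Ordinal.{u})),
    (∀ n, IsMaxAlmostDisjoint κ lam (restrict κ lam J A) (Q n)) →
    (∀ n, ∀ C ∈ Q (n + 1), ∃ B ∈ Q n, C ⊆ B) →
    ∃ f : ℕ → Set (Set Ordinal.{u}),
      (∀ n, f n ∈ Q n) ∧ (∀ n, f (n + 1) ⊆ f n) ∧ (⋂ n, f n).Nonempty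

def IsNowherePrecipitous (κ lam : Cardinal.{u}) (J : Set (Set (Set Ordinal.{u}))) : Prop :=
  ∀ A ∈ positive κ lam J, ¬ IsPrecipitous κ lam (restrict κ lam J A)

/-- The reduced cofinality of `J`: the least size of a `Y ⊆ J` such that every member of `J` is
covered by the union of fewer than `κ` members of `Y`. -/
noncomputable def cofBar (κ : Cardinal.{u}) (J : Set (Set (Set Ordinal.{u}))) :
    Cardinal.{u + 1} :=
  sInf {c | ∃ Y : Set (Set (Set Ordinal.{u})), Y ⊆ J ∧
    (∀ A ∈ J, ∃ y, y ⊆ Y ∧ #y < Cardinal.lift.{u + 1} κ ∧ A ⊆ ⋃₀ y) ∧ #Y = c}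

/-- `J` is a `[μ]^{<θ}`-normal ideal on `P_κ(λ)`: every `f` on a positive set `A` with
`f(a) ∈ P_{|a ∩ θ|}(a ∩ μ)` for all `a ∈ A` (hence with values in `P_θ(μ)`) is constant on a
positive subset of `A`. -/
structure IsNormalIdeal (κ lam μ θ : Cardinal.{u}) (J : Set (Set (Set Ordinal.{u}))) : Prop
    extends IsIdealOn κ lam J where
  exists_const : ∀ A ∈ positive κ lam J, ∀ f : Set Ordinal.{u} → Set Ordinal.{u},
    (∀ a ∈ A, f a ∈ smallSubsets #(a ∩ Iio θ.ord : Set Ordinal.{u}) (a ∩ Iio μ.ord)) →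
    ∃ B ∈ positive κ lam J, B ⊆ A ∧ ∃ e, ∀ a ∈ B, f a = e

/-- `NS_{κ,λ}^{[μ]^{<θ}}`, the smallest `[μ]^{<θ}`-normal ideal on `P_κ(λ)`, as the intersection
of all of them (see `isLeast_NSnormal`). -/
def NSnormal (κ lam μ θ : Cardinal.{u}) : Set (Set (Set Ordinal.{u})) :=
  ⋂₀ {J | IsNormalIdeal κ lam μ θ J}

theorem isLeast_NSnormal {κ lam μ θ : Cardinal.{u}} (h : ∃ J, IsNormalIdeal κ lam μ θ J) :
    IsLeast {J | IsNormalIdeal κ lam μ θ J} (NSnormal κ lam μ θ) := by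
  refine ⟨?_, fun J hJ => sInter_subset_of_mem hJ⟩
  obtain ⟨J₀, h₀⟩ := h
  refine ⟨⟨fun A hA => h₀.subset_PK A (hA J₀ h₀), ?_, fun hP => h₀.PK_notMem (hP J₀ h₀), ?_, ?_⟩,
    ?_⟩
  · exact fun A hA J hJ => hJ.noncofinal_subset hA
  · exact fun A hA B hB J hJ => hJ.downward A (hA J hJ) B hB
  · exact fun X hX hc J hJ => hJ.sUnion_mem X (fun A hA => hX hA J hJ) hc
  · rintro A ⟨hA, hAn⟩ f hf
    obtain ⟨J, hJ, hAJ⟩ : ∃ J, IsNormalIdeal κ lam μ θ J ∧ A ∉ J := by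
      by_contra! hc
      exact hAn fun J hJ => hc J hJ
    obtain ⟨B, ⟨hB, hBJ⟩, hBA, hconst⟩ := hJ.exists_const A ⟨hA, hAJ⟩ f hf
    exact ⟨B, ⟨hB, fun hBn => hBJ (hBn J hJ)⟩, hBA, hconst⟩

open Classical in
/-- `θ̄`: equal to `ν` if `θ = κ = ν⁺`, and to `θ` otherwise. -/
noncomputable def thetaBar (κ θ : Cardinal.{u}) : Cardinal.{u} :=
  if h : θ = κ ∧ ∃ ν : Cardinal.{u}, κ = Order.succ ν then h.2.choose else θ

/-- Closed unbounded subsets of `P_κ(λ)`. -/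
structure IsClubIn (κ lam : Cardinal.{u}) (C : Set (Set Ordinal.{u})) : Prop where
  subset_PK : C ⊆ PK κ lam
  unbounded : ∀ b ∈ PK κ lam, ∃ a ∈ C, b ⊆ a
  closed : ∀ X, X ⊆ C → X.Nonempty → IsChain (· ⊆ ·) X → #X < Cardinal.lift.{u + 1} κ →
    ⋃₀ X ∈ C

/-- `NS_{κ,λ}`, the ideal of nonstationary subsets of `P_κ(λ)`. -/
def nonstationary (κ lam : Cardinal.{u}) : Set (Set (Set Ordinal.{u})) :=
  {A | A ⊆ PK κ lam ∧ ∃ C, IsClubIn κ lam C ∧ A ∩ C = ∅}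

end PKappaLambda

/-!
Write `μ = cf λ`. As `λ` is the supremum of `μ` cardinals `σ < λ` for which
`NS_{κ,σ}^{[σ]^{<θ}}` has at most `λ` generators, these generators can be coded by ordinals
below `λ`. It follows that, inside a set `D` of the dual filter, `NS_{κ,λ}^{[λ]^{<θ}}` is generated
by the sets of those `a` that are not closed under some `g : μ → P_κ(λ)`. On a slice
`{a | a ∩ μ = x}` being closed under `g` depends only on `⋃ j ∈ x, g j`, so each `a` lies in at
most `2 ^ |a| ≤ 2 ^ μ < λ` traces of such closure sets, whereas the slices of a positive set have at
least `2 ^ μ` elements at positively many points. A positive set whose slices are injectively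
enumerated by ordinals therefore contains a positive set with a new enumeration that is smaller
at every point. Iterating along maximal almost disjoint families refutes precipitousness: a
decreasing sequence `f 0 ⊇ f 1 ⊇ ⋯` with a common point would yield infinitely descending ordinals.

For the nonstationary ideal, Menas's theorem gives `NS_{κ,λ} = NS_{κ,λ}^{[λ]^{<2}}`: every club
contains all the `a` closed under a suitable map from finite subsets of `λ` to `P_κ(λ)`.
-/

universe v

namespace PKappaLambda

section Descent

variable {α β : Type v}

theorem exists_injOn_lt_ord (S : Set α) :
    ∃ r : α → Ordinal.{v}, InjOn r S ∧ ∀ a ∈ S, r a < (#S).ord := by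
  classical
  have hcard : Cardinal.lift.{v + 1} #S = Cardinal.lift.{v} #(Iio (#S).ord) := by
    rw [Cardinal.mk_Iio_ordinal, card_ord, Cardinal.lift_id'.{v, v + 1}]
  obtain ⟨e⟩ := Cardinal.lift_mk_eq'.1 hcard
  refine ⟨fun a => if ha : a ∈ S then e ⟨a, ha⟩ else 0, fun a ha b hb hab => ?_, fun a ha => ?_⟩
  · simp only [ha, hb, dite_true] at hab
    simpa using e.injective (Subtype.ext hab)
  · simp only [ha, dite_true]
    exact (e ⟨a, ha⟩).2

theorem mk_le_of_injOn_lt {S : Set α} {r : α → Ordinal.{v}} {o : Ordinal.{v}} (hr : InjOn r S)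
    (h : ∀ a ∈ S, r a < o) : #S ≤ o.card := by
  have himage : Cardinal.lift.{v + 1} #S = #(r '' S) := by
    rw [← Cardinal.mk_image_eq_of_injOn_lift r S hr, Cardinal.lift_id'.{v, v + 1}]
  have hle : #(r '' S) ≤ #(Iio o) := Cardinal.mk_le_mk_of_subset (image_subset_iff.2 h)
  rw [← himage, Cardinal.mk_Iio_ordinal] at hle
  exact Cardinal.lift_le.1 hle

theorem exists_regressive_injOn {S : Set α} {r : α → Ordinal.{v}} (hr : InjOn r S)
    (𝒢 : Set (Set α)) :
    ∃ S' ⊆ S, ∃ r' : α → Ordinal.{v}, InjOn r' S' ∧ (∀ a ∈ S', r' a < r a) ∧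
      ∀ s ∈ 𝒢, ℵ₀ ≤ #(s ∩ S : Set α) → #𝒢 ≤ #(s ∩ S : Set α) → (s ∩ S').Nonempty := by
  obtain ⟨c, hc, hc_lt⟩ := exists_injOn_lt_ord 𝒢
  -- Since `r` enumerates `s ∩ S` injectively, it exceeds the index of `s` somewhere on `s ∩ S`.
  have exceeds : ∀ s ∈ 𝒢, ℵ₀ ≤ #(s ∩ S : Set α) → #𝒢 ≤ #(s ∩ S : Set α) →
      ∃ b ∈ s ∩ S, c s < r b := by
    intro s hs hinf hle
    by_contra! hno
    have hcard : #(s ∩ S : Set α) ≤ (Order.succ (c s)).card :=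
      mk_le_of_injOn_lt (hr.mono inter_subset_right) fun b hb => Order.lt_succ_of_le (hno b hb)
    have hlt : Order.succ (c s) < (#(s ∩ S : Set α)).ord :=
      (Cardinal.isSuccLimit_ord hinf).succ_lt
        ((hc_lt s hs).trans_le (Cardinal.ord_le_ord.2 hle))
    exact hcard.not_gt (Cardinal.lt_ord.1 hlt)
  let 𝒢' : Set (Set α) := {s ∈ 𝒢 | ∃ b ∈ s ∩ S, c s < r b}
  choose b hb hb_lt using fun s : 𝒢' => s.2.2
  let r' : α → Ordinal.{v} := fun a => sInf {o | ∃ s, b s = a ∧ c s = o}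
  have r'_spec : ∀ s, ∃ s' : 𝒢', b s' = b s ∧ c s' = r' (b s) := fun s =>
    csInf_mem (s := {o | ∃ s' : 𝒢', b s' = b s ∧ c s' = o}) ⟨c s, s, rfl, rfl⟩
  refine ⟨range b, range_subset_iff.2 fun s => (hb s).2, r', ?_, ?_, ?_⟩
  · rintro _ ⟨s, rfl⟩ _ ⟨t, rfl⟩ hst
    obtain ⟨s', hs', hcs⟩ := r'_spec s
    obtain ⟨t', ht', hct⟩ := r'_spec t
    have : s' = t' := Subtype.ext (hc s'.2.1 t'.2.1 (hcs.trans (hst.trans hct.symm)))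
    rw [← hs', ← ht', this]
  · rintro _ ⟨s, rfl⟩
    obtain ⟨s', hs', hcs⟩ := r'_spec s
    rw [← hcs, ← hs']
    exact hb_lt s'
  · intro s hs hinf hle
    let s' : 𝒢' := ⟨s, hs, exceeds s hs hinf hle⟩
    exact ⟨b s', (hb s').1, mem_range_self s'⟩

theorem mk_meeting_le {S : Set α} {𝒢 : Set (Set α)} {ν : Cardinal.{v}} (hν : ℵ₀ ≤ ν)
    (hS : S.Nonempty → ν ≤ #S) (h : ∀ a ∈ S, #{s ∈ 𝒢 | a ∈ s} ≤ ν) :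
    #{s ∈ 𝒢 | (s ∩ S).Nonempty} ≤ #S := by
  have hsub : {s ∈ 𝒢 | (s ∩ S).Nonempty} ⊆ ⋃ a : S, {s ∈ 𝒢 | a.1 ∈ s} := fun s ⟨hs, a, has, haS⟩ =>
    mem_iUnion.2 ⟨⟨a, haS⟩, hs, has⟩
  rcases S.eq_empty_or_nonempty with rfl | hne
  · simp
  calc #{s ∈ 𝒢 | (s ∩ S).Nonempty} ≤ #(⋃ a : S, {s ∈ 𝒢 | a.1 ∈ s}) :=
        Cardinal.mk_le_mk_of_subset hsub
    _ ≤ #S * ⨆ a : S, #{s ∈ 𝒢 | a.1 ∈ s} := Cardinal.mk_iUnion_le _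
    _ ≤ #S * #S := by
        gcongr
        exact ciSup_le' fun a => (h a a.2).trans (hS hne)
    _ = #S := Cardinal.mul_eq_self (hν.trans (hS hne))

/-- The grill of a family `𝒞` consists of the sets that meet every member of `𝒞`. When `𝒞` is a
base of the dual filter of an ideal, these are the positive sets. -/
def grill (𝒞 : Set (Set α)) : Set (Set α) :=
  {T | ∀ C ∈ 𝒞, (T ∩ C).Nonempty}

theorem inter_mem_grill {𝒞 : Set (Set α)} (h𝒞 : DirectedOn (· ⊇ ·) 𝒞) {T C : Set α}
    (hT : T ∈ grill 𝒞) (hC : C ∈ 𝒞) : T ∩ C ∈ grill 𝒞 := by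
  intro C' hC'
  obtain ⟨C'', hC'', hsub, hsub'⟩ := h𝒞 C hC C' hC'
  exact (hT C'' hC'').mono fun a ha => ⟨⟨ha.1, hsub ha.2⟩, hsub' ha.2⟩

/-- `r` enumerates each slice `T ∩ π ⁻¹' {x}` injectively by ordinals below the cardinal `k x`. -/
structure IsSliceRank (π : α → β) (T : Set α) (k : β → Cardinal.{v}) (r : α → Ordinal.{v}) :
    Prop where
  injOn : ∀ x, InjOn r (T ∩ π ⁻¹' {x})
  lt_ord : ∀ a ∈ T, r a < (k (π a)).ord

variable {π : α → β} {T : Set α} {k : β → Cardinal.{v}} {r : α → Ordinal.{v}}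

theorem IsSliceRank.mono (h : IsSliceRank π T k r) {T' : Set α} (hT : T' ⊆ T) :
    IsSliceRank π T' k r :=
  ⟨fun x => (h.injOn x).mono (inter_subset_inter_left _ hT), fun a ha => h.lt_ord a (hT ha)⟩

theorem exists_isSliceRank (π : α → β) (T : Set α) :
    ∃ r, IsSliceRank π T (fun x => #(T ∩ π ⁻¹' {x} : Set α)) r := by
  choose r hinj hlt using fun x => exists_injOn_lt_ord (T ∩ π ⁻¹' {x})
  refine ⟨fun a => r (π a) a, fun x => ?_, fun a ha => hlt _ a ⟨ha, rfl⟩⟩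
  exact (hinj x).congr fun a ha => by rw [show π a = x from ha.2]

theorem IsSliceRank.mk_slice_le (h : IsSliceRank π T k r) (x : β) :
    #(T ∩ π ⁻¹' {x} : Set α) ≤ k x := by
  have := mk_le_of_injOn_lt (h.injOn x) fun a ha => ha.2 ▸ h.lt_ord a ha.1
  rwa [card_ord] at this

variable {ν : Cardinal.{v}} {𝒞 : Set (Set α)}

theorem IsSliceRank.exists_lt_of_large (hr : IsSliceRank π T k r) (hν : ℵ₀ ≤ ν)
    (hlarge : ∀ a ∈ T, ν ≤ #(T ∩ π ⁻¹' {π a} : Set α))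
    (htrace : ∀ a ∈ T, #((· ∩ π ⁻¹' {π a}) '' {C ∈ 𝒞 | a ∈ C}) ≤ ν)
    (hfull : ∀ C ∈ 𝒞, ∃ a ∈ T ∩ C, k (π a) ≤ #(T ∩ C ∩ π ⁻¹' {π a} : Set α)) :
    ∃ T' ⊆ T, T' ∈ grill 𝒞 ∧ ∃ r', IsSliceRank π T' k r' ∧ ∀ a ∈ T', r' a < r a := by
  let slice : β → Set α := fun x => T ∩ π ⁻¹' {x}
  let traces : β → Set (Set α) := fun x => {s ∈ (· ∩ π ⁻¹' {x}) '' 𝒞 | (s ∩ slice x).Nonempty}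
  have traces_le : ∀ x, #(traces x) ≤ #(slice x) := by
    refine fun x => mk_meeting_le hν ?_ ?_
    · rintro ⟨a, ha, rfl⟩
      exact hlarge a ha
    · rintro a ⟨ha, rfl⟩
      refine (Cardinal.mk_le_mk_of_subset ?_).trans (htrace a ha)
      rintro _ ⟨⟨C, hC, rfl⟩, haC⟩
      exact ⟨C, ⟨hC, haC.1⟩, rfl⟩
  choose S hS r' hinj hlt hmeets using fun x => exists_regressive_injOn (hr.injOn x) (traces x)
  refine ⟨{a | a ∈ S (π a)}, fun a ha => (hS _ ha).1, fun C hC => ?_, fun a => r' (π a) a,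
    ⟨fun x => ?_, fun a ha => (hlt _ a ha).trans (hr.lt_ord a (hS _ ha).1)⟩,
    fun a ha => hlt _ a ha⟩
  · obtain ⟨a, ha, hk⟩ := hfull C hC
    have hle : k (π a) ≤ #(C ∩ π ⁻¹' {π a} ∩ slice (π a) : Set α) :=
      hk.trans (Cardinal.mk_le_mk_of_subset fun b hb => ⟨⟨hb.1.2, hb.2⟩, hb.1.1, hb.2⟩)
    have hslice : #(slice (π a)) ≤ k (π a) := hr.mk_slice_le _
    obtain ⟨b, hbC, hb⟩ := hmeets (π a) (C ∩ π ⁻¹' {π a})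
      ⟨⟨C, hC, rfl⟩, a, ⟨ha.2, rfl⟩, ha.1, rfl⟩
      (((hν.trans (hlarge a ha.1)).trans hslice).trans hle)
      (((traces_le _).trans hslice).trans hle)
    have hba : π b = π a := hbC.2
    exact ⟨b, show b ∈ S (π b) by rwa [hba], hbC.1⟩
  · refine ((hinj x).mono ?_).congr ?_
    · rintro a ⟨ha, rfl⟩
      exact ha
    · rintro a ⟨-, rfl⟩
      rfl

theorem IsSliceRank.exists_lt (hr : IsSliceRank π T k r) (h𝒞 : DirectedOn (· ⊇ ·) 𝒞)
    (hν : ℵ₀ ≤ ν) (hlarge : {a ∈ T | ν ≤ #(T ∩ π ⁻¹' {π a} : Set α)} ∈ grill 𝒞)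
    (htrace : ∀ a ∈ T, #((· ∩ π ⁻¹' {π a}) '' {C ∈ 𝒞 | a ∈ C}) ≤ ν) :
    ∃ T' ⊆ T, T' ∈ grill 𝒞 ∧ ∃ k' r', IsSliceRank π T' k' r' ∧
      ∀ a ∈ T', toLex (k' (π a), r' a) < toLex (k (π a), r a) := by
  by_cases hsmaller : ∃ T' ⊆ T, T' ∈ grill 𝒞 ∧ ∀ a ∈ T', #(T' ∩ π ⁻¹' {π a} : Set α) < k (π a)
  · obtain ⟨T', hT', hT'grill, hlt⟩ := hsmaller
    obtain ⟨r', hr'⟩ := exists_isSliceRank π T'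
    exact ⟨T', hT', hT'grill, _, r', hr', fun a ha => Prod.Lex.toLex_lt_toLex.2 (.inl (hlt a ha))⟩
  push Not at hsmaller
  let T₁ : Set α := {a ∈ T | ν ≤ #(T ∩ π ⁻¹' {π a} : Set α)}
  have hT₁ : T₁ ⊆ T := fun a ha => ha.1
  have hlarge₁ : ∀ a ∈ T₁, ν ≤ #(T₁ ∩ π ⁻¹' {π a} : Set α) := fun a ha =>
    ha.2.trans (Cardinal.mk_le_mk_of_subset fun b ⟨hb, hba⟩ =>
      ⟨⟨hb, by rw [show π b = π a from hba]; exact ha.2⟩, hba⟩)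
  obtain ⟨T', hT', hT'grill, r', hr', hlt⟩ := (hr.mono hT₁).exists_lt_of_large hν hlarge₁
    (fun a ha => htrace a (hT₁ ha))
    (fun C hC => hsmaller (T₁ ∩ C) (inter_subset_left.trans hT₁) (inter_mem_grill h𝒞 hlarge hC))
  exact ⟨T', hT'.trans hT₁, hT'grill, k, r', hr', fun a ha =>
    Prod.Lex.toLex_lt_toLex.2 (.inr ⟨rfl, hlt a ha⟩)⟩

end Descent

section Precipitous

variable {κ lam : Cardinal.{u}} {J : Set (Set (Set Ordinal.{u}))} {A : Set (Set Ordinal.{u})}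

theorem exists_isMaxAlmostDisjoint (hJ : IsLowerSet J) (P : Set (Set Ordinal.{u}) → Prop)
    (hP : ∀ C ∈ positive κ lam J, ∃ B ⊆ C, B ∈ positive κ lam J ∧ P B) :
    ∃ Q, IsMaxAlmostDisjoint κ lam J Q ∧ ∀ B ∈ Q, P B := by
  let F : Set (Set (Set (Set Ordinal.{u}))) :=
    {Q | (∀ B ∈ Q, B ∈ positive κ lam J ∧ P B) ∧ Q.Pairwise fun A B => A ∩ B ∈ J}
  obtain ⟨Q, hQ⟩ : ∃ Q, Maximal (· ∈ F) Q :=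
    zorn_subset F fun c hc hchain =>
      ⟨⋃₀ c, ⟨fun B ⟨Q, hQ, hB⟩ => (hc hQ).1 B hB,
        (pairwise_sUnion hchain.directedOn).2 fun Q hQ => (hc hQ).2⟩,
        fun Q hQ => subset_sUnion_of_mem hQ⟩
  refine ⟨Q, ⟨fun B hB => (hQ.prop.1 B hB).1, hQ.prop.2, fun C hC => ?_⟩,
    fun B hB => (hQ.prop.1 B hB).2⟩
  by_contra! hno
  obtain ⟨B, hBC, hB, hPB⟩ := hP C hC
  have hdisj : ∀ A ∈ Q, A ∩ B ∈ J := fun A hA => by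
    by_contra hAB
    exact hno A hA ⟨inter_subset_right.trans hC.1,
      fun hAC => hAB (hJ (inter_subset_inter_right A hBC) hAC)⟩
  have hinsert : insert B Q ∈ F :=
    ⟨forall_mem_insert.2 ⟨⟨hB, hPB⟩, hQ.prop.1⟩,
      hQ.prop.2.insert fun A hA _ => ⟨inter_comm A B ▸ hdisj A hA, hdisj A hA⟩⟩
  have hBQ : B ∈ Q := hQ.le_of_ge hinsert (subset_insert B Q) (mem_insert B Q)
  exact hB.2 (inter_self B ▸ hdisj B hBQ)

theorem IsMaxAlmostDisjoint.eq_of_subset {Q : Set (Set (Set Ordinal.{u}))}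
    (hQ : IsMaxAlmostDisjoint κ lam J Q) (hJ : IsLowerSet J) {B B' C : Set (Set Ordinal.{u})}
    (hC : C ∈ positive κ lam J) (hB : B ∈ Q) (hB' : B' ∈ Q) (hCB : C ⊆ B) (hCB' : C ⊆ B') :
    B = B' := by
  by_contra hne
  exact hC.2 (hJ (subset_inter hCB hCB') (hQ.inter_mem B hB B' hB' hne))

theorem isLowerSet_restrict (hJ : IsLowerSet J) (A : Set (Set Ordinal.{u})) :
    IsLowerSet (restrict κ lam J A) := fun _ _ hCB hB =>
  ⟨hCB.trans hB.1, hJ (inter_subset_inter_left A hCB) hB.2⟩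

theorem inter_mem_positive_of_restrict {B : Set (Set Ordinal.{u})}
    (hB : B ∈ positive κ lam (restrict κ lam J A)) : B ∩ A ∈ positive κ lam J :=
  ⟨inter_subset_left.trans hB.1, fun h => hB.2 ⟨hB.1, h⟩⟩

theorem mem_positive_restrict_of_subset {B : Set (Set Ordinal.{u})} (hB : B ∈ positive κ lam J)
    (hBA : B ⊆ A) : B ∈ positive κ lam (restrict κ lam J A) :=
  ⟨hB.1, fun h => hB.2 (inter_eq_left.2 hBA ▸ h.2)⟩

/-- `V T ρ` says that `ρ` is an admissible ranking of the members of `T`. Rankings exist on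
densely many `J`-positive sets, and each can be lowered pointwise on a smaller positive set. Such
a system with well-founded values is a winning strategy against precipitousness. -/
structure IsRankSystem {W : Type*} [LT W] (κ lam : Cardinal.{u})
    (J : Set (Set (Set Ordinal.{u})))
    (V : Set (Set Ordinal.{u}) → (Set Ordinal.{u} → W) → Prop) : Prop where
  mono : ∀ T ρ, V T ρ → ∀ T' ⊆ T, V T' ρ
  exists_rank : ∀ T ∈ positive κ lam J, ∃ T' ⊆ T, T' ∈ positive κ lam J ∧ ∃ ρ, V T' ρ
  exists_lt : ∀ T ∈ positive κ lam J, ∀ ρ, V T ρ →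
    ∃ T' ⊆ T, T' ∈ positive κ lam J ∧ ∃ ρ', V T' ρ' ∧ ∀ a ∈ T', ρ' a < ρ a

variable {W : Type*} [LT W] {V : Set (Set Ordinal.{u}) → (Set Ordinal.{u} → W) → Prop}

theorem IsRankSystem.restrict (hV : IsRankSystem κ lam J V) (A : Set (Set Ordinal.{u})) :
    IsRankSystem κ lam (restrict κ lam J A) V where
  mono := hV.mono
  exists_rank T hT := by
    obtain ⟨T', hT', hpos, hρ⟩ := hV.exists_rank _ (inter_mem_positive_of_restrict hT)
    exact ⟨T', hT'.trans inter_subset_left,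
      mem_positive_restrict_of_subset hpos (hT'.trans inter_subset_right), hρ⟩
  exists_lt T hT ρ hρ := by
    obtain ⟨T', hT', hpos, hlt⟩ := hV.exists_lt _ (inter_mem_positive_of_restrict hT) ρ
      (hV.mono T ρ hρ _ inter_subset_left)
    exact ⟨T', hT'.trans inter_subset_left,
      mem_positive_restrict_of_subset hpos (hT'.trans inter_subset_right), hlt⟩

theorem IsRankSystem.exists_refinement [Nonempty W] (hV : IsRankSystem κ lam J V)
    (hJ : IsLowerSet J) {Q : Set (Set (Set Ordinal.{u}))} (hQ : IsMaxAlmostDisjoint κ lam J Q)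
    {ρ : Set (Set Ordinal.{u}) → Set Ordinal.{u} → W} (hρ : ∀ B ∈ Q, V B (ρ B)) :
    ∃ Q', IsMaxAlmostDisjoint κ lam J Q' ∧ ∃ ρ' : Set (Set Ordinal.{u}) → Set Ordinal.{u} → W,
      (∀ C ∈ Q', V C (ρ' C)) ∧ ∀ C ∈ Q', ∃ B ∈ Q, C ⊆ B ∧ ∀ a ∈ C, ρ' C a < ρ B a := by
  obtain ⟨Q', hQ', hP⟩ := exists_isMaxAlmostDisjoint hJ
    (fun C => ∃ ρ', V C ρ' ∧ ∃ B ∈ Q, C ⊆ B ∧ ∀ a ∈ C, ρ' a < ρ B a) fun C hC => by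
      obtain ⟨B, hB, hBC⟩ := hQ.maximal C hC
      obtain ⟨T, hT, hpos, ρ', hρ', hlt⟩ :=
        hV.exists_lt _ hBC (ρ B) (hV.mono B _ (hρ B hB) _ inter_subset_left)
      exact ⟨T, hT.trans inter_subset_right, hpos, ρ', hρ', B, hB, hT.trans inter_subset_left, hlt⟩
  choose! ρ' hρ' using hP
  exact ⟨Q', hQ', ρ', fun C hC => (hρ' C hC).1, fun C hC => (hρ' C hC).2⟩

theorem IsRankSystem.exists_descending [Nonempty W] (hV : IsRankSystem κ lam J V)
    (hJ : IsLowerSet J) :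
    ∃ (Q : ℕ → Set (Set (Set Ordinal.{u})))
      (ρ : ℕ → Set (Set Ordinal.{u}) → Set Ordinal.{u} → W),
      (∀ n, IsMaxAlmostDisjoint κ lam J (Q n)) ∧
      ∀ n, ∀ C ∈ Q (n + 1), ∃ B ∈ Q n, C ⊆ B ∧ ∀ a ∈ C, ρ (n + 1) C a < ρ n B a := by
  let Stage := {p : Set (Set (Set Ordinal.{u})) ×
    (Set (Set Ordinal.{u}) → Set Ordinal.{u} → W) //
      IsMaxAlmostDisjoint κ lam J p.1 ∧ ∀ C ∈ p.1, V C (p.2 C)}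
  obtain ⟨Q₀, hQ₀, hP⟩ := exists_isMaxAlmostDisjoint hJ (fun C => ∃ ρ, V C ρ) hV.exists_rank
  choose! ρ₀ hρ₀ using hP
  have next : ∀ p : Stage, ∃ q : Stage, ∀ C ∈ q.1.1, ∃ B ∈ p.1.1, C ⊆ B ∧
      ∀ a ∈ C, q.1.2 C a < p.1.2 B a := fun p => by
    obtain ⟨Q, hQ, ρ, hρ, hlt⟩ := hV.exists_refinement hJ p.2.1 p.2.2
    exact ⟨⟨(Q, ρ), hQ, hρ⟩, hlt⟩
  choose next hnext using next
  let p : ℕ → Stage := fun n => next^[n] ⟨(Q₀, ρ₀), hQ₀, hρ₀⟩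
  refine ⟨fun n => (p n).1.1, fun n => (p n).1.2, fun n => (p n).2.1, fun n => ?_⟩
  have hp : p (n + 1) = next (p n) := Function.iterate_succ_apply' next n _
  simpa only [hp] using hnext (p n)

theorem IsRankSystem.not_isPrecipitous [Nonempty W] [WellFoundedLT W]
    (hV : IsRankSystem κ lam J V) (hJ : IsLowerSet J) (hA : A ∈ positive κ lam J) :
    ¬ IsPrecipitous κ lam J := by
  intro hprec
  have hK : IsLowerSet (PKappaLambda.restrict κ lam J A) := isLowerSet_restrict hJ A
  obtain ⟨Q, ρ, hQ, hdesc⟩ := (hV.restrict A).exists_descending hK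
  obtain ⟨f, hfQ, hf_anti, a, ha⟩ := hprec A hA Q hQ fun n C hC =>
    let ⟨B, hB, hCB, _⟩ := hdesc n C hC
    ⟨B, hB, hCB⟩
  have hlt : ∀ n, ρ (n + 1) (f (n + 1)) a < ρ n (f n) a := by
    intro n
    obtain ⟨B, hB, hfB, hρ⟩ := hdesc n _ (hfQ (n + 1))
    obtain rfl : B = f n := (hQ n).eq_of_subset hK ((hQ (n + 1)).subset_positive (hfQ (n + 1)))
      hB (hfQ n) hfB (hf_anti n)
    exact hρ a (mem_iInter.1 ha (n + 1))
  exact (wellFounded_iff_isEmpty_descending_chain.1 wellFounded_lt).elim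
    ⟨fun n => ρ n (f n) a, hlt⟩

theorem IsRankSystem.isNowherePrecipitous [Nonempty W] [WellFoundedLT W]
    (hV : IsRankSystem κ lam J V) (hJ : IsLowerSet J) : IsNowherePrecipitous κ lam J :=
  fun A hA => (hV.restrict A).not_isPrecipitous (isLowerSet_restrict hJ A)
    (mem_positive_restrict_of_subset hA Subset.rfl)

end Precipitous

section Ideals

variable {κ lam τ θ : Cardinal.{u}} {J : Set (Set (Set Ordinal.{u}))} {a b : Set Ordinal.{u}}

theorem PK_mono (hb : b ∈ PK κ lam) (h : a ⊆ b) : a ∈ PK κ lam :=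
  ⟨h.trans hb.1, (Cardinal.mk_le_mk_of_subset h).trans_lt hb.2⟩

theorem aleph0_lt_lift (hκ₀ : ℵ₀ < κ) : ℵ₀ < Cardinal.lift.{u + 1} κ := by
  rwa [← Cardinal.lift_aleph0.{u + 1, u}, Cardinal.lift_lt]

theorem finite_mem_PK (hκ₀ : ℵ₀ < κ) (ha : a.Finite) (h : a ⊆ Iio lam.ord) : a ∈ PK κ lam :=
  ⟨h, ha.lt_aleph0.trans (aleph0_lt_lift hκ₀)⟩

theorem singleton_mem_PK (hκ₀ : ℵ₀ < κ) {ξ : Ordinal.{u}} (h : ξ < lam.ord) : {ξ} ∈ PK κ lam :=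
  finite_mem_PK hκ₀ (finite_singleton ξ) (singleton_subset_iff.2 h)

theorem pair_mem_PK (hκ₀ : ℵ₀ < κ) (hlam : κ ≤ lam) : {0, 1} ∈ PK κ lam := by
  have hω : ω ≤ lam.ord := by
    rw [← Cardinal.ord_aleph0]
    exact Cardinal.ord_le_ord.2 (hκ₀.le.trans hlam)
  exact finite_mem_PK hκ₀ (toFinite _) (insert_subset (omega0_pos.trans_le hω)
    (singleton_subset_iff.2 (one_lt_omega0.trans_le hω)))

theorem union_mem_PK (hκ₀ : ℵ₀ < κ) (ha : a ∈ PK κ lam) (hb : b ∈ PK κ lam) : a ∪ b ∈ PK κ lam :=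
  ⟨union_subset ha.1 hb.1, (Cardinal.mk_union_le a b).trans_lt
    (Cardinal.add_lt_of_lt (aleph0_lt_lift hκ₀).le ha.2 hb.2)⟩

theorem biUnion_mem_PK {ι : Type (u + 1)} (hκ : κ.IsRegular) {s : Set ι}
    (hs : #s < Cardinal.lift.{u + 1} κ) {t : ι → Set Ordinal.{u}}
    (ht : ∀ i ∈ s, t i ∈ PK κ lam) : ⋃ i ∈ s, t i ∈ PK κ lam :=
  ⟨iUnion₂_subset fun i hi => (ht i hi).1,
    (Cardinal.card_biUnion_lt_iff_forall_of_isRegular (t := fun i _ => t i) hκ.lift hs).2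
      fun i hi => (ht i hi).2⟩

theorem inter_mem_PK (ha : a ∈ PK κ lam) : a ∩ Iio τ.ord ∈ PK κ τ :=
  ⟨inter_subset_right, (Cardinal.mk_le_mk_of_subset inter_subset_left).trans_lt ha.2⟩

theorem PK_subset_PK (h : τ ≤ lam) : PK κ τ ⊆ PK κ lam := fun _ ha =>
  ⟨ha.1.trans (Iio_subset_Iio (Cardinal.ord_le_ord.2 h)), ha.2⟩

theorem IsIdealOn.mem_of_subset (hJ : IsIdealOn κ lam J) {A B : Set (Set Ordinal.{u})}
    (hA : A ∈ J) (h : B ⊆ A) : B ∈ J :=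
  hJ.downward A hA B h

theorem IsIdealOn.isLowerSet (hJ : IsIdealOn κ lam J) : IsLowerSet J :=
  fun _ _ hBA hA => hJ.mem_of_subset hA hBA

theorem IsIdealOn.union_mem (hJ : IsIdealOn κ lam J) (hκ₀ : ℵ₀ < κ) {A B : Set (Set Ordinal.{u})}
    (hA : A ∈ J) (hB : B ∈ J) : A ∪ B ∈ J := by
  rw [← sUnion_pair]
  exact hJ.sUnion_mem _ (pair_subset hA hB)
    ((toFinite {A, B}).lt_aleph0.trans (aleph0_lt_lift hκ₀))

theorem IsIdealOn.not_cone_mem (hJ : IsIdealOn κ lam J) (hb : b ∈ PK κ lam) :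
    {a ∈ PK κ lam | ¬ b ⊆ a} ∈ J :=
  hJ.noncofinal_subset ⟨fun _ ha => ha.1, b, hb,
    eq_empty_of_forall_notMem fun _ ha => ha.1.2 ha.2⟩

theorem IsIdealOn.exists_superset (hJ : IsIdealOn κ lam J) {A : Set (Set Ordinal.{u})}
    (hA : A ∈ positive κ lam J) (hb : b ∈ PK κ lam) : ∃ a ∈ A, b ⊆ a := by
  by_contra! h
  exact hA.2 (hJ.mem_of_subset (hJ.not_cone_mem hb) fun a ha => ⟨hA.1 ha, h a ha⟩)

theorem two_le_mk_inter (hθ : 2 ≤ θ) (h : {0, 1} ⊆ a) :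
    2 ≤ #(a ∩ Iio θ.ord : Set Ordinal.{u}) := by
  have h2 : (2 : Ordinal.{u}) ≤ θ.ord := by
    rw [← Cardinal.ord_ofNat 2]
    exact Cardinal.ord_le_ord.2 hθ
  have hsub : ({0, 1} : Set Ordinal.{u}) ⊆ a ∩ Iio θ.ord := subset_inter h <|
    insert_subset (two_pos.trans_le h2) (singleton_subset_iff.2 (one_lt_two.trans_le h2))
  refine le_trans ?_ (Cardinal.mk_le_mk_of_subset hsub)
  rw [Cardinal.mk_insert (by simp), Cardinal.mk_singleton, one_add_one_eq_two]

theorem singleton_mem_smallSubsets (hθ : 2 ≤ θ) (h : {0, 1} ⊆ a) {ξ : Ordinal.{u}} (hξ : ξ ∈ a) :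
    {ξ} ∈ smallSubsets #(a ∩ Iio θ.ord : Set Ordinal.{u}) a := by
  refine ⟨singleton_subset_iff.2 hξ, ?_⟩
  rw [Cardinal.mk_singleton]
  exact Cardinal.one_lt_two.trans_le (two_le_mk_inter hθ h)

theorem IsNormalIdeal.small_diag_mem (hJ : IsNormalIdeal κ lam lam θ J) (hκ₀ : ℵ₀ < κ)
    {Z : Set Ordinal.{u} → Set (Set Ordinal.{u})} (hZ : ∀ e ∈ PK κ lam, Z e ∈ J) :
    {a ∈ PK κ lam | ∃ e ∈ smallSubsets #(a ∩ Iio θ.ord : Set Ordinal.{u}) a, a ∈ Z e} ∈ J := by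
  by_contra hno
  choose! f hf hfZ using fun a (ha : a ∈ {a ∈ PK κ lam |
    ∃ e ∈ smallSubsets #(a ∩ Iio θ.ord : Set Ordinal.{u}) a, a ∈ Z e}) => ha.2
  obtain ⟨B, hB, hBA, e, he⟩ := hJ.exists_const _ ⟨fun _ ha => ha.1, hno⟩ f fun a ha =>
    ⟨subset_inter (hf a ha).1 ((hf a ha).1.trans ha.1.1), (hf a ha).2⟩
  obtain ⟨a, ha, -⟩ := hJ.exists_superset hB (finite_mem_PK hκ₀ finite_empty (empty_subset _))
  have hePK : e ∈ PK κ lam := he a ha ▸ PK_mono (hB.1 ha) (hf a (hBA ha)).1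
  exact hB.2 (hJ.mem_of_subset (hZ e hePK) fun a ha => he a ha ▸ hfZ a (hBA ha))

theorem IsNormalIdeal.diag_mem (hJ : IsNormalIdeal κ lam lam θ J) (hκ₀ : ℵ₀ < κ)
    (hlam : κ ≤ lam) (hθ : 2 ≤ θ) {Z : Ordinal.{u} → Set (Set Ordinal.{u})}
    (hZ : ∀ ξ < lam.ord, Z ξ ∈ J) : {a ∈ PK κ lam | ∃ ξ ∈ a, a ∈ Z ξ} ∈ J := by
  have hsmall := hJ.small_diag_mem hκ₀ (Z := fun e => ⋃₀ (Z '' e)) fun e he =>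
    hJ.sUnion_mem _ (image_subset_iff.2 fun ξ hξ => hZ ξ (he.1 hξ))
      (Cardinal.mk_image_le.trans_lt he.2)
  refine hJ.mem_of_subset (hJ.union_mem hκ₀ hsmall (hJ.not_cone_mem (pair_mem_PK hκ₀ hlam))) ?_
  rintro a ⟨ha, ξ, hξ, haZ⟩
  by_cases h01 : {0, 1} ⊆ a
  · exact .inl ⟨ha, {ξ}, singleton_mem_smallSubsets hθ h01 hξ, Z ξ, mem_image_of_mem Z rfl, haZ⟩
  · exact .inr ⟨ha, h01⟩

theorem IsNormalIdeal.not_closed_mem (hJ : IsNormalIdeal κ lam lam θ J) (hκ₀ : ℵ₀ < κ)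
    (hlam : κ ≤ lam) (hθ : 2 ≤ θ) {g : Ordinal.{u} → Set Ordinal.{u}}
    (hg : ∀ ξ < lam.ord, g ξ ∈ PK κ lam) : {a ∈ PK κ lam | ∃ ξ ∈ a, ¬ g ξ ⊆ a} ∈ J :=
  hJ.mem_of_subset (hJ.diag_mem hκ₀ hlam hθ (Z := fun ξ => {a ∈ PK κ lam | ¬ g ξ ⊆ a})
    fun ξ hξ => hJ.not_cone_mem (hg ξ hξ)) fun _ ⟨ha, ξ, hξ, h⟩ => ⟨ha, ξ, hξ, ha, h⟩

end Ideals

section Projection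

variable {κ lam τ θ : Cardinal.{u}} {J : Set (Set (Set Ordinal.{u}))}

/-- The projection of `J` to `P_κ(τ)` along `a ↦ a ∩ τ`. -/
def projection (κ lam τ : Cardinal.{u}) (J : Set (Set (Set Ordinal.{u}))) :
    Set (Set (Set Ordinal.{u})) :=
  {B | B ⊆ PK κ τ ∧ {a ∈ PK κ lam | a ∩ Iio τ.ord ∈ B} ∈ J}

theorem IsIdealOn.projection (hJ : IsIdealOn κ lam J) (hτ : τ ≤ lam) :
    IsIdealOn κ τ (projection κ lam τ J) where
  subset_PK _ hB := hB.1
  noncofinal_subset := by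
    rintro B ⟨hB, b, hb, hbB⟩
    refine ⟨hB, hJ.mem_of_subset (hJ.not_cone_mem (PK_subset_PK hτ hb)) ?_⟩
    rintro a ⟨ha, haB⟩
    exact ⟨ha, fun hba => hbB.subset ⟨haB, subset_inter hba hb.1⟩⟩
  PK_notMem h := hJ.PK_notMem (hJ.mem_of_subset h.2 fun _ ha => ⟨ha, inter_mem_PK ha⟩)
  downward _ hA _ hBA := ⟨hBA.trans hA.1, hJ.mem_of_subset hA.2 fun _ ha => ⟨ha.1, hBA ha.2⟩⟩
  sUnion_mem X hX hcard := by
    refine ⟨sUnion_subset fun B hB => (hX hB).1, hJ.mem_of_subset (hJ.sUnion_mem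
      ((fun B => {a ∈ PK κ lam | a ∩ Iio τ.ord ∈ B}) '' X)
      (image_subset_iff.2 fun B hB => (hX hB).2) (Cardinal.mk_image_le.trans_lt hcard)) ?_⟩
    rintro a ⟨ha, B, hB, haB⟩
    exact ⟨_, mem_image_of_mem _ hB, ha, haB⟩

theorem IsNormalIdeal.projection (hJ : IsNormalIdeal κ lam lam θ J) (hθτ : θ ≤ τ) (hτ : τ ≤ lam) :
    IsNormalIdeal κ τ τ θ (projection κ lam τ J) where
  toIsIdealOn := hJ.toIsIdealOn.projection hτ
  exists_const := by
    rintro B ⟨hB, hBJ⟩ f hf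
    have hpos : {a ∈ PK κ lam | a ∩ Iio τ.ord ∈ B} ∈ positive κ lam J :=
      ⟨fun _ ha => ha.1, fun h => hBJ ⟨hB, h⟩⟩
    obtain ⟨A, hA, hAB, e, he⟩ := hJ.exists_const _ hpos (fun a => f (a ∩ Iio τ.ord)) fun a ha => by
      have hfa := hf _ ha.2
      rw [inter_assoc a, inter_eq_right.2 (Iio_subset_Iio (Cardinal.ord_le_ord.2 hθτ))] at hfa
      exact ⟨hfa.1.trans fun ξ hξ => ⟨hξ.1.1, ha.1.1 hξ.1.1⟩, hfa.2⟩
    exact ⟨{x ∈ B | f x = e}, ⟨fun x hx => hB hx.1, fun h => hA.2 (hJ.mem_of_subset h.2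
      fun a ha => ⟨hA.1 ha, (hAB ha).2, he a ha⟩)⟩, fun x hx => hx.1, e, fun x hx => hx.2⟩

theorem IsNormalIdeal.preimage_mem (hJ : IsNormalIdeal κ lam lam θ J) (hθτ : θ ≤ τ)
    (hτ : τ ≤ lam) {y : Set (Set Ordinal.{u})} (hy : y ∈ NSnormal κ τ τ θ) :
    {a ∈ PK κ lam | a ∩ Iio τ.ord ∈ y} ∈ J :=
  (hy _ (hJ.projection hθτ hτ)).2

end Projection

section Arithmetic

variable {κ lam : Cardinal.{u}}

theorem power_le_of_lt_cof (hlam : ℵ₀ ≤ lam) {c : Cardinal.{u}} (hc : c < lam.ord.cof)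
    (h : ∀ τ < lam, τ ^ c ≤ lam) : lam ^ c ≤ lam := by
  induction c using Cardinal.inductionOn with | mk ι
  let X := lam.ord.ToType
  have bounded : (univ : Set (ι → X)) ⊆ ⋃ x : X, univ.pi fun _ => Iio x := by
    intro f _
    have hnot : ¬ IsCofinal (range f) := fun hcofinal => by
      have hle := (Order.cof_le hcofinal).trans Cardinal.mk_range_le
      rw [Ordinal.cof_toType] at hle
      exact hle.not_gt hc
    obtain ⟨x, hx⟩ : ∃ x, ∀ i, f i < x := by simpa [IsCofinal] using hnot
    exact mem_iUnion.2 ⟨x, fun i _ => hx i⟩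
  have pi_le : ∀ x : X, #(univ.pi fun _ : ι => Iio x) ≤ lam := fun x => by
    rw [Cardinal.mk_congr (Equiv.Set.univPi fun _ : ι => Iio x), ← Cardinal.power_def]
    exact h _ ((Cardinal.mk_Iio_lt x (by rw [mk_ord_toType, Ordinal.type_toType])).trans_eq
      (mk_ord_toType lam))
  calc lam ^ #ι = #(univ : Set (ι → X)) := by
        rw [Cardinal.mk_univ, ← Cardinal.power_def, mk_ord_toType]
    _ ≤ #X * ⨆ x : X, #(univ.pi fun _ : ι => Iio x) :=
        (Cardinal.mk_le_mk_of_subset bounded).trans (Cardinal.mk_iUnion_le _)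
    _ ≤ lam * lam := by
        gcongr
        · exact (mk_ord_toType lam).le
        · exact ciSup_le' pi_le
    _ = lam := Cardinal.mul_eq_self hlam

theorem thetaBar_le (κ θ : Cardinal.{u}) : thetaBar κ θ ≤ θ := by
  unfold thetaBar
  split_ifs with h
  · exact (Order.le_succ _).trans (h.2.choose_spec.ge.trans h.1.ge)
  · exact le_rfl

theorem exists_bounds (hlam : 0 < lam) (hcf : κ ≤ lam.ord.cof) :
    ∃ o : Ordinal.{u} → Ordinal.{u}, (∀ j, o j < lam.ord) ∧
      ∀ b ∈ PK κ lam, ∃ j < lam.ord.cof.ord, b ⊆ Iio (o j) := by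
  obtain ⟨s, hs, hcard⟩ := Order.exists_cof_eq (Iio lam.ord)
  rw [Ordinal.cof_Iio, ← Ordinal.lift_cof] at hcard
  have hcard' : #(Iio lam.ord.cof.ord) = #s := by
    rw [Cardinal.mk_Iio_ordinal, card_ord, hcard]
  obtain ⟨e⟩ := Cardinal.eq.1 hcard'
  refine ⟨Function.extend Subtype.val (fun j => (e j).1.1) 0, fun j => ?_, fun b hb => ?_⟩
  · by_cases hj : ∃ i : Iio lam.ord.cof.ord, i.1 = j
    · obtain ⟨i, rfl⟩ := hj
      rw [Subtype.val_injective.extend_apply]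
      exact (e i).1.2
    · rw [Function.extend_apply' _ _ _ hj]
      exact Cardinal.lt_ord.2 (Ordinal.card_zero.trans_lt hlam)
  have hlt : #b < (Ordinal.lift.{u + 1} lam.ord).cof := by
    rw [← Ordinal.lift_cof]
    exact hb.2.trans_le (Cardinal.lift_le.2 hcf)
  obtain ⟨y, hy, hle⟩ := hs ⟨_, Ordinal.sSup_add_one_lt_of_lt_cof hlt hb.1⟩
  have hb_bdd : BddAbove ((fun x => x + 1) '' b) :=
    ⟨lam.ord, forall_mem_image.2 fun x hx => Order.add_one_le_of_lt (hb.1 hx)⟩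
  refine ⟨e.symm ⟨y, hy⟩, (e.symm ⟨y, hy⟩).2, ?_⟩
  rw [Subtype.val_injective.extend_apply, e.apply_symm_apply]
  exact fun x hx => (Order.lt_add_one_iff.2 le_rfl).trans_le
    ((le_csSup hb_bdd (mem_image_of_mem _ hx)).trans hle)

theorem exists_cofBar_eq (hκ₀ : ℵ₀ < κ) (I : Set (Set (Set Ordinal.{u}))) :
    ∃ Y ⊆ I, (∀ A ∈ I, ∃ y ⊆ Y, #y < Cardinal.lift.{u + 1} κ ∧ A ⊆ ⋃₀ y) ∧ #Y = cofBar κ I :=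
  csInf_mem (s := {c | ∃ Y ⊆ I,
    (∀ A ∈ I, ∃ y ⊆ Y, #y < Cardinal.lift.{u + 1} κ ∧ A ⊆ ⋃₀ y) ∧ #Y = c})
    ⟨_, I, Subset.rfl, fun A hA => ⟨{A}, singleton_subset_iff.2 hA,
      (finite_singleton A).lt_aleph0.trans (aleph0_lt_lift hκ₀), by rw [sUnion_singleton]⟩, rfl⟩

theorem exists_generators {I : Set (Set (Set Ordinal.{u}))} (hκ₀ : ℵ₀ < κ) (hI : ∅ ∈ I)
    (h : cofBar κ I ≤ Cardinal.lift.{u + 1} lam) :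
    ∃ y : Ordinal.{u} → Set (Set Ordinal.{u}), (∀ ξ, y ξ ∈ I) ∧
      ∀ A ∈ I, ∃ b ∈ PK κ lam, A ⊆ ⋃ ξ ∈ b, y ξ := by
  obtain ⟨Y, hYI, hY, hcard⟩ := exists_cofBar_eq hκ₀ I
  obtain ⟨e⟩ : #Y ≤ #(Iio lam.ord) := by
    rwa [Cardinal.mk_Iio_ordinal, card_ord, hcard]
  let code : Y → Ordinal.{u} := fun A => (e A).1
  have hcode : Function.Injective code := Subtype.val_injective.comp e.injective
  refine ⟨Function.extend code Subtype.val fun _ => ∅, fun ξ => ?_, fun A hA => ?_⟩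
  · by_cases hξ : ∃ A, code A = ξ
    · obtain ⟨A, rfl⟩ := hξ
      rw [hcode.extend_apply]
      exact hYI A.2
    · rwa [Function.extend_apply' _ _ _ hξ]
  · obtain ⟨y, hyY, hy_card, hAy⟩ := hY A hA
    refine ⟨code '' (Subtype.val ⁻¹' y), ⟨?_, ?_⟩, fun a ha => ?_⟩
    · exact image_subset_iff.2 fun B _ => (e B).2
    · exact Cardinal.mk_image_le.trans_lt
        ((Cardinal.mk_preimage_of_injective _ _ Subtype.val_injective).trans_lt hy_card)
    · obtain ⟨B, hB, haB⟩ := hAy ha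
      refine mem_iUnion₂.2 ⟨code ⟨B, hyY hB⟩, mem_image_of_mem code hB, ?_⟩
      rwa [hcode.extend_apply]

end Arithmetic

section ClosureIdeal

variable {κ lam μ : Cardinal.{u}} {D T : Set (Set Ordinal.{u})}
  {g g' : Ordinal.{u} → Set Ordinal.{u}}

/-- The sets `a` that are closed under the set mapping `g` on `a ∩ μ`. -/
def closedSets (μ : Cardinal.{u}) (g : Ordinal.{u} → Set Ordinal.{u}) : Set (Set Ordinal.{u}) :=
  {a | ∀ j ∈ a, j < μ.ord → g j ⊆ a}

/-- The filter base formed by the sets `D ∩ closedSets μ g` for `g : μ → P_κ(λ)`. Only the values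
of `g` below `μ` matter. -/
def closureBase (κ lam μ : Cardinal.{u}) (D : Set (Set Ordinal.{u})) :
    Set (Set (Set Ordinal.{u})) :=
  (fun g => D ∩ closedSets μ g) '' {g | ∀ j, g j ∈ PK κ lam}

/-- The ideal dual to the filter generated by `closureBase κ lam μ D`. -/
def closureIdeal (κ lam μ : Cardinal.{u}) (D : Set (Set Ordinal.{u})) :
    Set (Set (Set Ordinal.{u})) :=
  {Z | Z ⊆ PK κ lam ∧ Z ∉ grill (closureBase κ lam μ D)}

theorem mem_closureIdeal : T ∈ closureIdeal κ lam μ D ↔ T ⊆ PK κ lam ∧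
    ∃ g : Ordinal.{u} → Set Ordinal.{u}, (∀ j, g j ∈ PK κ lam) ∧
      ∀ a ∈ T, a ∈ D → a ∉ closedSets μ g := by
  simp only [closureIdeal, closureBase, grill, mem_ofPred_eq, forall_mem_image, not_forall,
    not_nonempty_iff_eq_empty, eq_empty_iff_forall_notMem, mem_inter_iff, not_and, exists_prop]

theorem mem_positive_closureIdeal : T ∈ positive κ lam (closureIdeal κ lam μ D) ↔
    T ⊆ PK κ lam ∧ T ∈ grill (closureBase κ lam μ D) :=
  and_congr_right fun hT => by simp only [closureIdeal, mem_ofPred_eq, hT, true_and, not_not]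

theorem closedSets_anti (h : ∀ j, g j ⊆ g' j) : closedSets μ g' ⊆ closedSets μ g :=
  fun _ ha j hj hjμ => (h j).trans (ha j hj hjμ)

theorem directedOn_closureBase (hκ₀ : ℵ₀ < κ) :
    DirectedOn (· ⊇ ·) (closureBase κ lam μ D) := by
  rintro _ ⟨g, hg, rfl⟩ _ ⟨g', hg', rfl⟩
  exact ⟨_, mem_image_of_mem _ (fun j => union_mem_PK hκ₀ (hg j) (hg' j)),
    inter_subset_inter_right _ (closedSets_anti fun _ => subset_union_left),
    inter_subset_inter_right _ (closedSets_anti fun _ => subset_union_right)⟩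

theorem isIdealOn_closureIdeal (hκ : κ.IsRegular) (hD : ∀ a ∈ D, (a ∩ Iio μ.ord).Nonempty)
    (hproper : PK κ lam ∉ closureIdeal κ lam μ D) :
    IsIdealOn κ lam (closureIdeal κ lam μ D) where
  subset_PK _ hA := hA.1
  noncofinal_subset := by
    rintro A ⟨hA, b, hb, hbA⟩
    refine mem_closureIdeal.2 ⟨hA, fun _ => b, fun _ => hb, fun a ha haD hcl => ?_⟩
    obtain ⟨j, hj, hjμ⟩ := hD a haD
    exact hbA.subset ⟨ha, hcl j hj hjμ⟩
  PK_notMem := hproper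
  downward A hA B hBA := by
    obtain ⟨hAPK, g, hg, hAg⟩ := mem_closureIdeal.1 hA
    exact mem_closureIdeal.2 ⟨hBA.trans hAPK, g, hg, fun a ha => hAg a (hBA ha)⟩
  sUnion_mem X hX hcard := by
    choose! g hg hXg using fun A (hA : A ∈ X) => (mem_closureIdeal.1 (hX hA)).2
    refine mem_closureIdeal.2 ⟨sUnion_subset fun A hA => (hX hA).1, fun j => ⋃ A ∈ X, g A j,
      fun j => biUnion_mem_PK hκ hcard fun A hA => hg A hA j, ?_⟩
    rintro a ⟨A, hA, ha⟩ haD hcl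
    exact hXg A hA a ha haD
      (closedSets_anti (fun j => subset_biUnion_of_mem (u := fun A => g A j) hA) hcl)

theorem IsNormalIdeal.closureIdeal_subset {θ : Cardinal.{u}} {J : Set (Set (Set Ordinal.{u}))}
    (hJ : IsNormalIdeal κ lam lam θ J) (hκ₀ : ℵ₀ < κ) (hlam : κ ≤ lam) (hθ : 2 ≤ θ)
    (hD : PK κ lam \ D ∈ J) : closureIdeal κ lam μ D ⊆ J := by
  intro Z hZ
  obtain ⟨hZPK, g, hg, hZg⟩ := mem_closureIdeal.1 hZ
  refine hJ.mem_of_subset (hJ.union_mem hκ₀ hD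
    (hJ.not_closed_mem hκ₀ hlam hθ fun ξ _ => hg ξ)) fun a ha => ?_
  by_contra! hno
  simp only [mem_union, not_or, mem_sdiff, mem_ofPred_eq, hZPK ha, true_and, not_not, not_exists,
    not_and] at hno
  exact hZg a ha hno.1 fun j hj _ => hno.2 j hj

end ClosureIdeal

section Ladder

variable {κ lam μ θ : Cardinal.{u}} {J : Set (Set (Set Ordinal.{u}))}
  {Λ : Ordinal.{u} → Cardinal.{u}} {y : Ordinal.{u} → Ordinal.{u} → Set (Set Ordinal.{u})}

/-- Cardinals `Λ j < λ` (`j < μ`) whose initial ordinals bound all members of `P_κ(λ)`, each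
with generators `y j ξ` of the least `[Λ j]^{<θ}`-normal ideal that are indexed by ordinals below
`λ`. For convenience `Λ` and `y` are total functions; only `j < μ` and `ξ < λ` matter. -/
structure IsLadder (κ lam μ θ : Cardinal.{u}) (Λ : Ordinal.{u} → Cardinal.{u})
    (y : Ordinal.{u} → Ordinal.{u} → Set (Set Ordinal.{u})) : Prop where
  kappa_le : ∀ j, κ ≤ Λ j
  theta_le : ∀ j, θ ≤ Λ j
  mu_le : ∀ j, μ ≤ Λ j
  lt : ∀ j, Λ j < lam
  bounded : ∀ b ∈ PK κ lam, ∃ j < μ.ord, b ⊆ Iio (Λ j).ord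
  mem_NSnormal : ∀ j ξ, y j ξ ∈ NSnormal κ (Λ j) (Λ j) θ
  generate : ∀ j, ∀ A ∈ NSnormal κ (Λ j) (Λ j) θ, ∃ b ∈ PK κ lam, A ⊆ ⋃ ξ ∈ b, y j ξ

/-- The `a ∈ P_κ(λ)` that meet `μ`, bound their own small subsets by some `Λ j` with
`j ∈ a ∩ μ`, and whose traces on these `Λ j` avoid the sets `y j ξ`, `ξ ∈ a`. -/
def coherentSets (κ lam μ θ : Cardinal.{u}) (Λ : Ordinal.{u} → Cardinal.{u})
    (y : Ordinal.{u} → Ordinal.{u} → Set (Set Ordinal.{u})) : Set (Set Ordinal.{u}) :=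
  {a ∈ PK κ lam | (a ∩ Iio μ.ord).Nonempty ∧
    (∀ e ∈ smallSubsets #(a ∩ Iio θ.ord : Set Ordinal.{u}) a,
      ∃ j ∈ a, j < μ.ord ∧ e ⊆ Iio (Λ j).ord) ∧
    ∀ j ∈ a, j < μ.ord → ∀ ξ ∈ a, a ∩ Iio (Λ j).ord ∉ y j ξ}

theorem IsLadder.kappa_le_lam (hL : IsLadder κ lam μ θ Λ y) : κ ≤ lam :=
  (hL.kappa_le 0).trans (hL.lt 0).le

theorem IsLadder.mu_ord_le_lam_ord (hL : IsLadder κ lam μ θ Λ y) : μ.ord ≤ lam.ord :=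
  Cardinal.ord_le_ord.2 ((hL.mu_le 0).trans (hL.lt 0).le)

theorem IsLadder.diff_coherentSets_mem (hL : IsLadder κ lam μ θ Λ y)
    (hJ : IsNormalIdeal κ lam lam θ J) (hκ₀ : ℵ₀ < κ) (hθ : 2 ≤ θ) :
    PK κ lam \ coherentSets κ lam μ θ Λ y ∈ J := by
  have hsingle {j : Ordinal.{u}} (hj : j < μ.ord) : {j} ∈ PK κ lam :=
    singleton_mem_PK hκ₀ (hj.trans_le hL.mu_ord_le_lam_ord)
  obtain ⟨j₀, hj₀, -⟩ := hL.bounded ∅ (finite_mem_PK hκ₀ finite_empty (empty_subset _))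
  have hmeet := hJ.not_cone_mem (hsingle hj₀)
  have hbound := hJ.small_diag_mem hκ₀
    (Z := fun e => {a ∈ PK κ lam | ∀ j ∈ a, j < μ.ord → ¬ e ⊆ Iio (Λ j).ord}) fun e he => by
      obtain ⟨j, hj, hej⟩ := hL.bounded e he
      exact hJ.mem_of_subset (hJ.not_cone_mem (hsingle hj)) fun a ha =>
        ⟨ha.1, fun hja => ha.2 j (hja rfl) hj hej⟩
  have havoid := hJ.diag_mem hκ₀ hL.kappa_le_lam hθ fun j _ =>
    hJ.diag_mem hκ₀ hL.kappa_le_lam hθ fun ξ _ =>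
      hJ.preimage_mem (hL.theta_le j) (hL.lt j).le (hL.mem_NSnormal j ξ)
  refine hJ.mem_of_subset (hJ.union_mem hκ₀ hmeet (hJ.union_mem hκ₀ hbound havoid)) ?_
  rintro a ⟨ha, hcoh⟩
  by_contra hno
  simp only [mem_union, not_or] at hno
  refine hcoh ⟨ha, by_contra fun h => hno.1 ⟨ha, fun hj => h ⟨j₀, hj rfl, hj₀⟩⟩, fun e he => ?_,
    fun j hj _ ξ hξ h => hno.2.2 ⟨ha, j, hj, ha, ξ, hξ, ha, h⟩⟩
  by_contra! h
  exact hno.2.1 ⟨ha, e, he, ha, h⟩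

theorem setOf_not_closed_mem_NSnormal {τ : Cardinal.{u}} (hκ₀ : ℵ₀ < κ) (hτ : κ ≤ τ) (hθ : 2 ≤ θ)
    {h : Set Ordinal.{u} → Ordinal.{u} → Set Ordinal.{u}}
    (hh : ∀ e k, #(h e k) < Cardinal.lift.{u + 1} κ) :
    {x ∈ PK κ τ | ∃ e ∈ smallSubsets #(x ∩ Iio θ.ord : Set Ordinal.{u}) x,
      ∃ k ∈ x, ¬ h e k ∩ Iio τ.ord ⊆ x} ∈ NSnormal κ τ τ θ := by
  intro I hI
  have := hI.small_diag_mem hκ₀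
    (Z := fun e => {x ∈ PK κ τ | ∃ k ∈ x, ¬ h e k ∩ Iio τ.ord ⊆ x}) fun e _ =>
      hI.not_closed_mem hκ₀ hτ hθ fun k _ =>
        ⟨inter_subset_right, (Cardinal.mk_le_mk_of_subset inter_subset_left).trans_lt (hh e k)⟩
  exact hI.mem_of_subset this fun x ⟨hx, e, he, k, hk, h⟩ => ⟨hx, e, he, hx, k, hk, h⟩

theorem IsLadder.exists_forall_inter_subset (hL : IsLadder κ lam μ θ Λ y) (hκ₀ : ℵ₀ < κ)
    (hθ : 2 ≤ θ) {h : Set Ordinal.{u} → Ordinal.{u} → Set Ordinal.{u}}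
    (hh : ∀ e k, #(h e k) < Cardinal.lift.{u + 1} κ) :
    ∃ G : Ordinal.{u} → Set Ordinal.{u}, (∀ j, G j ∈ PK κ lam) ∧
      ∀ a ∈ coherentSets κ lam μ θ Λ y ∩ closedSets μ G, ∀ j ∈ a, j < μ.ord →
        ∀ k ∈ a, k < μ.ord → ∀ e ∈ smallSubsets #(a ∩ Iio θ.ord : Set Ordinal.{u}) a,
          e ⊆ Iio (Λ j).ord → h e k ∩ Iio (Λ j).ord ⊆ a := by
  choose G hG hGy using fun j => hL.generate j _
    (setOf_not_closed_mem_NSnormal hκ₀ (hL.kappa_le j) hθ hh)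
  refine ⟨G, hG, fun a ⟨hcoh, hcl⟩ j hj hjμ k hk hkμ e he hej => ?_⟩
  by_contra hsub
  have hθj := Iio_subset_Iio (Cardinal.ord_le_ord.2 (hL.theta_le j))
  obtain ⟨ξ, hξ, haξ⟩ := mem_iUnion₂.1 <| hGy j ⟨inter_mem_PK hcoh.1, e,
    ⟨subset_inter he.1 hej, by rw [inter_assoc a, inter_eq_right.2 hθj]; exact he.2⟩, k,
    ⟨hk, hkμ.trans_le (Cardinal.ord_le_ord.2 (hL.mu_le j))⟩,
    fun h => hsub (h.trans inter_subset_left)⟩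
  exact hcoh.2.2.2 j hj hjμ ξ (hcl j hj hjμ hξ) haξ

theorem IsLadder.exists_forall_mem_closedSets (hL : IsLadder κ lam μ θ Λ y) (hκ₀ : ℵ₀ < κ)
    (hθ : 2 ≤ θ) {g : Set Ordinal.{u} → Ordinal.{u} → Set Ordinal.{u}}
    (hg : ∀ e k, g e k ∈ PK κ lam) :
    ∃ G : Ordinal.{u} → Set Ordinal.{u}, (∀ j, G j ∈ PK κ lam) ∧
      ∀ a ∈ coherentSets κ lam μ θ Λ y ∩ closedSets μ G,
        ∀ e ∈ smallSubsets #(a ∩ Iio θ.ord : Set Ordinal.{u}) a, a ∈ closedSets μ (g e) := by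
  choose! b hbμ hb using fun (e : Set Ordinal.{u}) (he : e ∈ PK κ lam) k =>
    hL.bounded _ (union_mem_PK hκ₀ he (hg e k))
  -- Adjoining `b e k` brings into `a` an index whose `Λ` bounds all of `g e k`.
  obtain ⟨G, hG, hGa⟩ := hL.exists_forall_inter_subset hκ₀ hθ
    (h := fun e k => g e k ∪ {b e k}) fun e k => (Cardinal.mk_union_le _ _).trans_lt <|
      Cardinal.add_lt_of_lt (aleph0_lt_lift hκ₀).le (hg e k).2
        ((finite_singleton _).lt_aleph0.trans (aleph0_lt_lift hκ₀))
  refine ⟨G, hG, fun a ha e he k hk hkμ => ?_⟩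
  have hePK : e ∈ PK κ lam := PK_mono ha.1.1 he.1
  have hebk := union_subset_iff.1 (hb e hePK k)
  obtain ⟨j, hj, hjμ, hej⟩ := ha.1.2.2.1 e he
  have hba : b e k ∈ a := hGa a ha j hj hjμ k hk hkμ e he hej
    ⟨.inr rfl, (hbμ e hePK k).trans_le (Cardinal.ord_le_ord.2 (hL.mu_le j))⟩
  exact fun η hη => hGa a ha _ hba (hbμ e hePK k) k hk hkμ e he hebk.1 ⟨.inl hη, hebk.2 hη⟩

theorem IsLadder.isNormalIdeal_closureIdeal (hL : IsLadder κ lam μ θ Λ y) (hκ : κ.IsRegular)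
    (hκ₀ : ℵ₀ < κ) (hθ : 2 ≤ θ)
    (hproper : PK κ lam ∉ closureIdeal κ lam μ (coherentSets κ lam μ θ Λ y)) :
    IsNormalIdeal κ lam lam θ (closureIdeal κ lam μ (coherentSets κ lam μ θ Λ y)) where
  toIsIdealOn := isIdealOn_closureIdeal hκ (fun _ ha => ha.2.1) hproper
  exists_const := by
    rintro A ⟨hA, hApos⟩ F hF
    by_contra! hno
    have hfib : ∀ e, {a ∈ A | F a = e} ∈
        closureIdeal κ lam μ (coherentSets κ lam μ θ Λ y) := by
      intro e
      by_contra hpos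
      obtain ⟨a, ha, hne⟩ := hno _ ⟨fun a ha => hA ha.1, hpos⟩ (fun a ha => ha.1) e
      exact hne ha.2
    choose g hg hgF using fun e => (mem_closureIdeal.1 (hfib e)).2
    obtain ⟨G, hG, hGa⟩ := hL.exists_forall_mem_closedSets hκ₀ hθ hg
    exact hApos (mem_closureIdeal.2 ⟨hA, G, hG, fun a ha hcoh hcl => hgF (F a) a ⟨ha, rfl⟩ hcoh
      (hGa a ⟨hcoh, hcl⟩ _ ⟨(hF a ha).1.trans inter_subset_left, (hF a ha).2⟩)⟩)

theorem IsLadder.NSnormal_eq_closureIdeal (hL : IsLadder κ lam μ θ Λ y) (hκ : κ.IsRegular)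
    (hκ₀ : ℵ₀ < κ) (hθ : 2 ≤ θ) (hex : ∃ J, IsNormalIdeal κ lam lam θ J) :
    NSnormal κ lam lam θ = closureIdeal κ lam μ (coherentSets κ lam μ θ Λ y) := by
  have hN := (isLeast_NSnormal hex).1
  have hsub : closureIdeal κ lam μ (coherentSets κ lam μ θ Λ y) ⊆ NSnormal κ lam lam θ :=
    hN.closureIdeal_subset hκ₀ hL.kappa_le_lam hθ (hL.diff_coherentSets_mem hN hκ₀ hθ)
  exact Subset.antisymm ((isLeast_NSnormal hex).2
    (hL.isNormalIdeal_closureIdeal hκ hκ₀ hθ fun h => hN.PK_notMem (hsub h))) hsub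

end Ladder

section NowherePrecipitous

variable {κ lam μ θ : Cardinal.{u}} {D : Set (Set Ordinal.{u})}

theorem mk_setOf_small_slice_le {α β : Type v} {π : α → β} {T : Set α} {ν : Cardinal.{v}}
    (hν : ℵ₀ ≤ ν) (hrange : #(range π) ≤ ν) :
    #{a ∈ T | #(T ∩ π ⁻¹' {π a} : Set α) < ν} ≤ ν := by
  let R : Set α := {a ∈ T | #(T ∩ π ⁻¹' {π a} : Set α) < ν}
  have fibre_le : ∀ x, #(R ∩ π ⁻¹' {x} : Set α) ≤ ν := fun x => by
    rcases (R ∩ π ⁻¹' {x}).eq_empty_or_nonempty with h | ⟨a, ⟨-, ha⟩, rfl⟩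
    · simp only [h, Cardinal.mk_eq_zero, zero_le]
    · exact (Cardinal.mk_le_mk_of_subset (inter_subset_inter_left _ fun b hb => hb.1)).trans ha.le
  have hcover : R ⊆ ⋃ x ∈ range π, R ∩ π ⁻¹' {x} := fun a ha =>
    mem_iUnion₂.2 ⟨π a, mem_range_self a, ha, rfl⟩
  calc #R ≤ #(range π) * ⨆ x : range π, #(R ∩ π ⁻¹' {x.1} : Set α) :=
        (Cardinal.mk_le_mk_of_subset hcover).trans (Cardinal.mk_biUnion_le _ _)
    _ ≤ ν * ν := mul_le_mul' hrange (ciSup_le' fun x => fibre_le x)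
    _ = ν := Cardinal.mul_eq_self hν

theorem mem_noncofinal_of_mk_sUnion_lt (hκ₀ : ℵ₀ < κ) {R : Set (Set Ordinal.{u})}
    (hR : R ⊆ PK κ lam) (h : #(⋃₀ R) < Cardinal.lift.{u + 1} lam) : R ∈ noncofinal κ lam := by
  obtain ⟨ξ, hξ, hξR⟩ : ∃ ξ ∈ Iio lam.ord, ξ ∉ ⋃₀ R := by
    by_contra! hsub
    refine (Cardinal.mk_le_mk_of_subset hsub).not_gt ?_
    rwa [Cardinal.mk_Iio_ordinal, card_ord]
  exact ⟨hR, {ξ}, singleton_mem_PK hκ₀ hξ, eq_empty_of_forall_notMem fun a ha =>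
    hξR ⟨a, ha.1, ha.2 rfl⟩⟩

theorem setOf_small_slice_mem_noncofinal (hκ₀ : ℵ₀ < κ) (hκμ : κ ≤ μ) (h2 : 2 ^ μ < lam)
    {T : Set (Set Ordinal.{u})} (hT : T ⊆ PK κ lam) :
    {a ∈ T | #(T ∩ (· ∩ Iio μ.ord) ⁻¹' {a ∩ Iio μ.ord} : Set (Set Ordinal.{u})) <
      Cardinal.lift.{u + 1} (2 ^ μ)} ∈ noncofinal κ lam := by
  have hκν : κ ≤ 2 ^ μ := hκμ.trans (Cardinal.cantor μ).le
  have hν : ℵ₀ ≤ Cardinal.lift.{u + 1} (2 ^ μ) := Cardinal.aleph0_le_lift.2 (hκ₀.le.trans hκν)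
  have hrange : #(range fun a : Set Ordinal.{u} => a ∩ Iio μ.ord) ≤
      Cardinal.lift.{u + 1} (2 ^ μ) := by
    refine (Cardinal.mk_le_mk_of_subset (t := 𝒫 (Iio μ.ord))
      (range_subset_iff.2 fun a => inter_subset_right)).trans_eq ?_
    rw [Cardinal.mk_powerset, Cardinal.mk_Iio_ordinal, card_ord, Cardinal.lift_power,
      Cardinal.lift_two]
  refine mem_noncofinal_of_mk_sUnion_lt hκ₀ (fun a ha => hT ha.1)
    (lt_of_le_of_lt ?_ (Cardinal.lift_lt.2 h2))
  refine (Cardinal.mk_sUnion_le _).trans ((mul_le_mul' (mk_setOf_small_slice_le hν hrange)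
    (ciSup_le' fun a => ?_)).trans (Cardinal.mul_eq_self hν).le)
  exact (hT a.2.1).2.le.trans (Cardinal.lift_le.2 hκν)

theorem mk_traces_le (a : Set Ordinal.{u}) :
    #((· ∩ (· ∩ Iio μ.ord) ⁻¹' {a ∩ Iio μ.ord}) '' {C ∈ closureBase κ lam μ D | a ∈ C} :
      Set (Set (Set Ordinal.{u}))) ≤ 2 ^ #a := by
  -- On the slice of `a`, the set `closedSets μ g` depends only on `⋃ j ∈ a ∩ μ, g j`.
  let trace : Set Ordinal.{u} → Set (Set Ordinal.{u}) := fun U =>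
    {b ∈ D | U ⊆ b ∧ b ∩ Iio μ.ord = a ∩ Iio μ.ord}
  rw [← Cardinal.mk_powerset]
  refine (Cardinal.mk_le_mk_of_subset (t := trace '' 𝒫 a) ?_).trans Cardinal.mk_image_le
  rintro _ ⟨_, ⟨⟨g, -, rfl⟩, -, ha⟩, rfl⟩
  refine ⟨⋃ j ∈ a ∩ Iio μ.ord, g j, iUnion₂_subset fun j hj => ha j hj.1 hj.2, ?_⟩
  ext b
  have hclosed : b ∩ Iio μ.ord = a ∩ Iio μ.ord →
      (⋃ j ∈ a ∩ Iio μ.ord, g j ⊆ b ↔ b ∈ closedSets μ g) := fun h => by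
    rw [← h, iUnion₂_subset_iff]
    exact ⟨fun hb j hj hjμ => hb j ⟨hj, hjμ⟩, fun hb j hj => hb j hj.1 hj.2⟩
  exact ⟨fun ⟨hbD, hU, hba⟩ => ⟨⟨hbD, (hclosed hba).1 hU⟩, hba⟩,
    fun ⟨⟨hbD, hb⟩, hba⟩ => ⟨hbD, (hclosed hba).2 hb, hba⟩⟩

theorem isRankSystem_closureIdeal (hκ₀ : ℵ₀ < κ) (hκμ : κ ≤ μ) (h2 : 2 ^ μ < lam)
    (hI : IsIdealOn κ lam (closureIdeal κ lam μ D)) :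
    IsRankSystem κ lam (closureIdeal κ lam μ D) fun T ρ =>
      ∃ (k : Set Ordinal.{u} → Cardinal.{u + 1}) (r : Set Ordinal.{u} → Ordinal.{u + 1}),
        IsSliceRank (· ∩ Iio μ.ord) T k r ∧ ρ = fun a => toLex (k (a ∩ Iio μ.ord), r a) where
  mono := by
    rintro T _ ⟨k, r, hr, rfl⟩ T' hT'
    exact ⟨k, r, hr.mono hT', rfl⟩
  exists_rank T hT := by
    obtain ⟨r, hr⟩ := exists_isSliceRank (· ∩ Iio μ.ord) T
    exact ⟨T, Subset.rfl, hT, _, _, r, hr, rfl⟩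
  exists_lt := by
    rintro T hT _ ⟨k, r, hr, rfl⟩
    have hν : ℵ₀ ≤ Cardinal.lift.{u + 1} (2 ^ μ) :=
      Cardinal.aleph0_le_lift.2 ((hκ₀.le.trans hκμ).trans (Cardinal.cantor μ).le)
    have hlarge : {a ∈ T | Cardinal.lift.{u + 1} (2 ^ μ) ≤
        #(T ∩ (· ∩ Iio μ.ord) ⁻¹' {a ∩ Iio μ.ord} : Set (Set Ordinal.{u}))} ∈
          grill (closureBase κ lam μ D) := by
      refine (mem_positive_closureIdeal.1 ⟨fun a ha => hT.1 ha.1, fun hmem => hT.2 ?_⟩).2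
      refine hI.mem_of_subset (hI.union_mem hκ₀ hmem (hI.noncofinal_subset
        (setOf_small_slice_mem_noncofinal hκ₀ hκμ h2 hT.1))) fun a ha => ?_
      exact (le_or_gt _ _).imp (fun h => ⟨ha, h⟩) fun h => ⟨ha, h⟩
    have htrace : ∀ a ∈ T, #((· ∩ (· ∩ Iio μ.ord) ⁻¹' {a ∩ Iio μ.ord}) ''
        {C ∈ closureBase κ lam μ D | a ∈ C} : Set (Set (Set Ordinal.{u}))) ≤
          Cardinal.lift.{u + 1} (2 ^ μ) := fun a ha => by
      refine (mk_traces_le a).trans ?_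
      rw [Cardinal.lift_power, Cardinal.lift_two]
      exact Cardinal.power_le_power_left two_ne_zero
        ((hT.1 ha).2.le.trans (Cardinal.lift_le.2 hκμ))
    obtain ⟨T', hT', hgrill, k', r', hr', hlt⟩ :=
      hr.exists_lt (directedOn_closureBase hκ₀) hν hlarge htrace
    exact ⟨T', hT', mem_positive_closureIdeal.2 ⟨hT'.trans hT.1, hgrill⟩, _, ⟨k', r', hr', rfl⟩,
      hlt⟩

theorem exists_isLadder (hκ₀ : ℵ₀ < κ) (hlam : lam.IsSingular) (hcf : κ ≤ lam.ord.cof)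
    (hθ : θ < lam) (hcof : ∀ τ < lam, ∃ σ, τ ≤ σ ∧ σ < lam ∧
      cofBar κ (NSnormal κ σ σ θ) ≤ Cardinal.lift.{u + 1} lam) :
    ∃ Λ y, IsLadder κ lam lam.ord.cof θ Λ y := by
  obtain ⟨o, ho, hbdd⟩ := exists_bounds (hlam.cof_ord_lt.bot_lt) hcf
  choose Λ hle hlt hΛ using fun j => hcof (max (max lam.ord.cof θ) (Order.succ (o j).card))
    (max_lt (max_lt hlam.cof_ord_lt hθ) (hlam.isSuccLimit.succ_lt (Cardinal.lt_ord.1 (ho j))))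
  choose y hy hgen using fun j => exists_generators (I := NSnormal κ (Λ j) (Λ j) θ) hκ₀
    (fun I hI => hI.mem_of_subset
      (hI.not_cone_mem (finite_mem_PK hκ₀ finite_empty (empty_subset _))) (empty_subset _)) (hΛ j)
  have hcofΛ j : max lam.ord.cof θ ≤ Λ j := (le_max_left _ _).trans (hle j)
  refine ⟨Λ, y, fun j => hcf.trans ((le_max_left _ _).trans (hcofΛ j)),
    fun j => (le_max_right _ _).trans (hcofΛ j), fun j => (le_max_left _ _).trans (hcofΛ j), hlt,
    fun b hb => ?_, hy, hgen⟩
  obtain ⟨j, hj, hbj⟩ := hbdd b hb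
  exact ⟨j, hj, hbj.trans (Iio_subset_Iio ((lt_ord_succ_card _).le.trans
    (Cardinal.ord_le_ord.2 ((le_max_right _ _).trans (hle j)))))⟩

theorem proposition3p4_general (hκ : κ.IsRegular) (hκ₀ : ℵ₀ < κ) (hcf : κ ≤ lam.ord.cof)
    (h2 : 2 ^ lam.ord.cof < lam) (hθ : 2 ≤ θ) (hθlam : θ < lam)
    (hex : ∃ J, IsNormalIdeal κ lam lam θ J)
    (hcof : ∀ τ < lam, ∃ σ, τ ≤ σ ∧ σ < lam ∧
      cofBar κ (NSnormal κ σ σ θ) ≤ Cardinal.lift.{u + 1} lam) :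
    IsNowherePrecipitous κ lam (NSnormal κ lam lam θ) := by
  have hcf_lt : lam.ord.cof < lam := (Cardinal.cantor _).trans h2
  have hlam : lam.IsSingular := Cardinal.IsSingular.of_not_isRegular
    ((hκ₀.le.trans hcf).trans hcf_lt.le) fun h => h.cof_ord.not_lt hcf_lt
  obtain ⟨Λ, y, hL⟩ := exists_isLadder hκ₀ hlam hcf hθlam hcof
  have hI := (isLeast_NSnormal hex).1.toIsIdealOn
  rw [hL.NSnormal_eq_closureIdeal hκ hκ₀ hθ hex] at hI ⊢
  exact (isRankSystem_closureIdeal hκ₀ hcf h2 hI).isNowherePrecipitous hI.isLowerSet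

end NowherePrecipitous

section Club

variable {κ lam : Cardinal.{u}} {C : Set (Set Ordinal.{u})} {J : Set (Set (Set Ordinal.{u}))}

theorem mk_range_nat_lt (hκ₀ : ℵ₀ < κ) {α : Type (u + 1)} (f : ℕ → α) :
    #(range f) < Cardinal.lift.{u + 1} κ :=
  (countable_range f).le_aleph0.trans_lt (aleph0_lt_lift hκ₀)

theorem sUnion_mem_PK (hκ : κ.IsRegular) {X : Set (Set Ordinal.{u})} (hX : X ⊆ PK κ lam)
    (hcard : #X < Cardinal.lift.{u + 1} κ) : ⋃₀ X ∈ PK κ lam := by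
  rw [sUnion_eq_biUnion]
  exact biUnion_mem_PK hκ hcard fun a ha => hX ha

theorem IsClubIn.sUnion_mem_of_tail (hC : IsClubIn κ lam C) {X : Set (Set Ordinal.{u})}
    (hX : IsChain (· ⊆ ·) X) (hcard : #X < Cardinal.lift.{u + 1} κ) {a₀ : Set Ordinal.{u}}
    (ha₀ : a₀ ∈ X) (h : ∀ a ∈ X, a₀ ⊆ a → a ∈ C) : ⋃₀ X ∈ C := by
  have hle : ⋃₀ X ⊆ ⋃₀ {a ∈ X | a₀ ⊆ a} := sUnion_subset fun a ha => by
    rcases hX.total ha ha₀ with haa₀ | ha₀a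
    · exact haa₀.trans (subset_sUnion_of_mem ⟨ha₀, Subset.rfl⟩)
    · exact subset_sUnion_of_mem ⟨ha, ha₀a⟩
  rw [hle.antisymm (sUnion_subset_sUnion fun a ha => ha.1)]
  exact hC.closed _ (fun a ha => h a ha.1 ha.2) ⟨a₀, ha₀, Subset.rfl⟩
    (hX.mono fun a ha => ha.1) ((Cardinal.mk_le_mk_of_subset fun a ha => ha.1).trans_lt hcard)

theorem IsClubIn.iUnion_mem_of_interleaved (hC : IsClubIn κ lam C) (hκ₀ : ℵ₀ < κ)
    {B : ℕ → Set Ordinal.{u}} (hB : Monotone B) {m : ℕ}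
    (h : ∀ n ≥ m, ∃ c ∈ C, B n ⊆ c ∧ c ⊆ B (n + 1)) : ⋃ n, B n ∈ C := by
  choose c hcC hBc hcB using fun n => h (m + n) (Nat.le_add_right m n)
  have hc : Monotone c := monotone_nat_of_le_succ fun n => (hcB n).trans (hBc (n + 1))
  have heq : ⋃ n, B n = ⋃₀ range c := by
    rw [sUnion_range]
    exact (iUnion_subset fun n => ((hB (Nat.le_add_left n m)).trans (hBc n)).trans
      (subset_iUnion c n)).antisymm (iUnion_subset fun n => (hcB n).trans (subset_iUnion B _))
  rw [heq]
  exact hC.closed _ (range_subset_iff.2 hcC) (range_nonempty c) hc.isChain_range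
    (mk_range_nat_lt hκ₀ c)

/-- A continuous assignment of fewer than `κ` indices to each member of `P_κ(λ)`: the index sets
of diagonal intersections `{a | ∀ i ∈ N a, a ∈ C i}` of clubs. Constant assignments give the
plain intersections of fewer than `κ` clubs. -/
structure IsContinuousIndexing {ι : Type (u + 1)} (κ lam : Cardinal.{u})
    (N : Set Ordinal.{u} → Set ι) : Prop where
  mk_lt : ∀ a ∈ PK κ lam, #(N a) < Cardinal.lift.{u + 1} κ
  mono : Monotone N
  exists_mem : ∀ X : Set (Set Ordinal.{u}), X.Nonempty → ∀ i ∈ N (⋃₀ X), ∃ a ∈ X, i ∈ N a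

section DiagonalIntersection

variable {ι : Type (u + 1)} {N : Set Ordinal.{u} → Set ι} {C : ι → Set (Set Ordinal.{u})}

theorem IsContinuousIndexing.exists_superset_mem_diag (hN : IsContinuousIndexing κ lam N)
    (hκ : κ.IsRegular) (hκ₀ : ℵ₀ < κ) (hC : ∀ i, IsClubIn κ lam (C i)) {b : Set Ordinal.{u}}
    (hb : b ∈ PK κ lam) : ∃ a ∈ {a ∈ PK κ lam | ∀ i ∈ N a, a ∈ C i}, b ⊆ a := by
  choose! c hcC hc using fun i => (hC i).unbounded
  let B : ℕ → Set Ordinal.{u} := fun n => Nat.rec b (fun _ x => x ∪ ⋃ i ∈ N x, c i x) n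
  have hB_succ n : B (n + 1) = B n ∪ ⋃ i ∈ N (B n), c i (B n) := rfl
  have hB n : B n ∈ PK κ lam := by
    induction n with
    | zero => exact hb
    | succ n ih =>
      exact union_mem_PK hκ₀ ih (biUnion_mem_PK hκ (hN.mk_lt _ ih) fun i _ =>
        (hC i).subset_PK (hcC i _ ih))
  have hB_mono : Monotone B := monotone_nat_of_le_succ fun n => subset_union_left
  have hunion : ⋃₀ range B ∈ PK κ lam :=
    sUnion_mem_PK hκ (range_subset_iff.2 hB) (mk_range_nat_lt hκ₀ B)
  refine ⟨⋃₀ range B, ⟨hunion, fun i hi => ?_⟩, subset_sUnion_of_mem ⟨0, rfl⟩⟩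
  obtain ⟨_, ⟨m, rfl⟩, him⟩ := hN.exists_mem _ (range_nonempty B) i hi
  rw [sUnion_range]
  refine (hC i).iUnion_mem_of_interleaved hκ₀ hB_mono (m := m) fun n hmn =>
    ⟨c i (B n), hcC i _ (hB n), hc i _ (hB n), ?_⟩
  rw [hB_succ]
  exact (subset_biUnion_of_mem (u := fun i => c i (B n)) (hN.mono (hB_mono hmn) him)).trans
    subset_union_right

theorem IsContinuousIndexing.isClubIn_diag (hN : IsContinuousIndexing κ lam N)
    (hκ : κ.IsRegular) (hκ₀ : ℵ₀ < κ) (hC : ∀ i, IsClubIn κ lam (C i)) :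
    IsClubIn κ lam {a ∈ PK κ lam | ∀ i ∈ N a, a ∈ C i} where
  subset_PK _ ha := ha.1
  unbounded _ hb := hN.exists_superset_mem_diag hκ hκ₀ hC hb
  closed X hX hne hchain hcard := by
    refine ⟨sUnion_mem_PK hκ (fun a ha => (hX ha).1) hcard, fun i hi => ?_⟩
    obtain ⟨a₀, ha₀, hi₀⟩ := hN.exists_mem X hne i hi
    exact (hC i).sUnion_mem_of_tail hchain hcard ha₀ fun a ha ha₀a =>
      (hX ha).2 i (hN.mono ha₀a hi₀)

end DiagonalIntersection

theorem isContinuousIndexing_const {ι : Type (u + 1)} {s : Set ι}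
    (hs : #s < Cardinal.lift.{u + 1} κ) : IsContinuousIndexing κ lam fun _ => s :=
  ⟨fun _ _ => hs, fun _ _ _ => Subset.rfl, fun _ ⟨a, ha⟩ _ hi => ⟨a, ha, hi⟩⟩

theorem isContinuousIndexing_subsingletons (hκ₀ : ℵ₀ < κ) :
    IsContinuousIndexing κ lam fun a => {e | e ⊆ a ∧ e.Subsingleton} where
  mk_lt a ha := by
    have hsub : {e | e ⊆ a ∧ e.Subsingleton} ⊆ {∅} ∪ singleton '' a := by
      rintro e ⟨hea, he⟩
      rcases he.eq_empty_or_singleton with rfl | ⟨ξ, rfl⟩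
      · exact Or.inl rfl
      · exact Or.inr ⟨ξ, hea rfl, rfl⟩
    exact ((Cardinal.mk_le_mk_of_subset hsub).trans (Cardinal.mk_union_le _ _)).trans_lt
      (Cardinal.add_lt_of_lt (aleph0_lt_lift hκ₀).le
        ((finite_singleton _).lt_aleph0.trans (aleph0_lt_lift hκ₀))
        (Cardinal.mk_image_le.trans_lt ha.2))
  mono _ _ hab _ he := ⟨he.1.trans hab, he.2⟩
  exists_mem := by
    rintro X ⟨a, ha⟩ e ⟨heX, he⟩
    rcases he.eq_empty_or_singleton with rfl | ⟨ξ, rfl⟩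
    · exact ⟨a, ha, empty_subset _, he⟩
    · obtain ⟨b, hb, hξ⟩ := heX rfl
      exact ⟨b, hb, singleton_subset_iff.2 hξ, he⟩

theorem isClubIn_cone (hκ : κ.IsRegular) (hκ₀ : ℵ₀ < κ) {b : Set Ordinal.{u}}
    (hb : b ∈ PK κ lam) : IsClubIn κ lam {a ∈ PK κ lam | b ⊆ a} where
  subset_PK _ ha := ha.1
  unbounded d hd := ⟨b ∪ d, ⟨union_mem_PK hκ₀ hb hd, subset_union_left⟩, subset_union_right⟩
  closed X hX hne _ hcard := by
    obtain ⟨a, ha⟩ := hne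
    exact ⟨sUnion_mem_PK hκ (fun a ha => (hX ha).1) hcard,
      (hX ha).2.trans (subset_sUnion_of_mem ha)⟩

theorem isIdealOn_nonstationary (hκ : κ.IsRegular) (hκ₀ : ℵ₀ < κ) :
    IsIdealOn κ lam (nonstationary κ lam) where
  subset_PK _ hA := hA.1
  noncofinal_subset := by
    rintro A ⟨hA, b, hb, hbA⟩
    exact ⟨hA, _, isClubIn_cone hκ hκ₀ hb,
      subset_empty_iff.1 ((subset_of_eq hbA).trans' fun a ha => ⟨ha.1, ha.2.2⟩)⟩
  PK_notMem := by
    rintro ⟨-, C, hC, hdisj⟩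
    obtain ⟨a, ha, -⟩ := hC.unbounded ∅ (finite_mem_PK hκ₀ finite_empty (empty_subset _))
    exact notMem_empty a (hdisj ▸ ⟨hC.subset_PK ha, ha⟩)
  downward := by
    rintro A ⟨hA, C, hC, hdisj⟩ B hB
    exact ⟨hB.trans hA, C, hC,
      subset_empty_iff.1 ((inter_subset_inter_left C hB).trans hdisj.subset)⟩
  sUnion_mem X hX hcard := by
    choose C hC hdisj using fun A : X => (hX A.2).2
    have huniv : #(univ : Set X) < Cardinal.lift.{u + 1} κ := by rwa [Cardinal.mk_univ]
    refine ⟨sUnion_subset fun A hA => (hX hA).1, _,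
      (isContinuousIndexing_const huniv).isClubIn_diag hκ hκ₀ hC,
      eq_empty_of_forall_notMem ?_⟩
    rintro a ⟨⟨A, hA, ha⟩, -, haC⟩
    exact notMem_empty a (hdisj ⟨A, hA⟩ ▸ ⟨ha, haC _ (mem_univ _)⟩)

theorem subsingleton_of_mem_smallSubsets_two {a S e : Set Ordinal.{u}}
    (he : e ∈ smallSubsets #(a ∩ Iio (2 : Cardinal.{u}).ord : Set Ordinal.{u}) S) :
    e.Subsingleton := by
  have h2 : #(a ∩ Iio (2 : Cardinal.{u}).ord : Set Ordinal.{u}) ≤ 2 := by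
    refine (Cardinal.mk_le_mk_of_subset inter_subset_right).trans ?_
    rw [Cardinal.mk_Iio_ordinal, card_ord, Cardinal.lift_ofNat]
  rw [← Cardinal.mk_le_one_iff_set_subsingleton, ← Order.lt_succ_iff]
  refine (he.2.trans_le h2).trans_eq ?_
  simpa [one_add_one_eq_two] using (Cardinal.succ_natCast 1).symm

theorem isNormalIdeal_nonstationary (hκ : κ.IsRegular) (hκ₀ : ℵ₀ < κ) :
    IsNormalIdeal κ lam lam 2 (nonstationary κ lam) where
  toIsIdealOn := isIdealOn_nonstationary hκ hκ₀
  exists_const := by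
    rintro A ⟨hA, hAn⟩ f hf
    by_contra! hno
    have fibre_mem e : {a ∈ A | f a = e} ∈ nonstationary κ lam := by
      by_contra hpos
      obtain ⟨a, ha, hne⟩ := hno _ ⟨fun a ha => hA ha.1, hpos⟩ (fun a ha => ha.1) e
      exact hne ha.2
    choose C hC hdisj using fun e => (fibre_mem e).2
    refine hAn ⟨hA, _, (isContinuousIndexing_subsingletons hκ₀).isClubIn_diag hκ hκ₀ hC,
      eq_empty_of_forall_notMem ?_⟩
    rintro a ⟨ha, -, haC⟩
    exact notMem_empty a (hdisj (f a) ▸ ⟨⟨ha, rfl⟩, haC _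
      ⟨(hf a ha).1.trans inter_subset_left, subsingleton_of_mem_smallSubsets_two (hf a ha)⟩⟩)

theorem IsNormalIdeal.not_card_closed_mem {θ : Cardinal.{u}} (hJ : IsNormalIdeal κ lam lam θ J)
    (hκ₀ : ℵ₀ < κ) (hlam : κ ≤ lam) (hθ : 2 ≤ θ) (k : ℕ) {G : Finset Ordinal.{u} → Set Ordinal.{u}}
    (hG : ∀ e : Finset Ordinal.{u}, ↑e ⊆ Iio lam.ord → G e ∈ PK κ lam) :
    {a ∈ PK κ lam | ∃ e : Finset Ordinal.{u}, e.card = k ∧ ↑e ⊆ a ∧ ¬ G e ⊆ a} ∈ J := by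
  classical
  induction k generalizing G with
  | zero =>
    refine hJ.mem_of_subset (hJ.not_cone_mem (hG ∅ (by simp))) ?_
    rintro a ⟨ha, e, he, -, hGe⟩
    exact ⟨ha, Finset.card_eq_zero.1 he ▸ hGe⟩
  | succ k ih =>
    refine hJ.mem_of_subset (hJ.diag_mem hκ₀ hlam hθ fun ξ hξ =>
      ih (G := fun e => G (insert ξ e)) fun e he => hG _ ?_) ?_
    · rw [Finset.coe_insert]
      exact insert_subset hξ he
    · rintro a ⟨ha, e, he, hea, hGe⟩
      obtain ⟨ξ, e', -, rfl, he'⟩ := Finset.card_eq_succ.1 he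
      rw [Finset.coe_insert, insert_subset_iff] at hea
      exact ⟨ha, ξ, hea.1, ha, e', he', hea.2, hGe⟩

theorem IsNormalIdeal.not_finset_closed_mem {θ : Cardinal.{u}} (hJ : IsNormalIdeal κ lam lam θ J)
    (hκ₀ : ℵ₀ < κ) (hlam : κ ≤ lam) (hθ : 2 ≤ θ) {G : Finset Ordinal.{u} → Set Ordinal.{u}}
    (hG : ∀ e : Finset Ordinal.{u}, ↑e ⊆ Iio lam.ord → G e ∈ PK κ lam) :
    {a ∈ PK κ lam | ∃ e : Finset Ordinal.{u}, ↑e ⊆ a ∧ ¬ G e ⊆ a} ∈ J := by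
  refine hJ.mem_of_subset (hJ.sUnion_mem _ (range_subset_iff.2 fun k =>
    hJ.not_card_closed_mem hκ₀ hlam hθ k hG) (mk_range_nat_lt hκ₀ _)) ?_
  rintro a ⟨ha, e, hea, hGe⟩
  exact ⟨_, ⟨e.card, rfl⟩, ha, e, rfl, hea, hGe⟩

theorem IsClubIn.exists_monotone_finset_map (hC : IsClubIn κ lam C) (hκ : κ.IsRegular)
    (hκ₀ : ℵ₀ < κ) : ∃ F : Finset Ordinal.{u} → Set Ordinal.{u}, Monotone F ∧
      (∀ e : Finset Ordinal.{u}, ↑e ⊆ F e) ∧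
      ∀ e : Finset Ordinal.{u}, ↑e ⊆ Iio lam.ord → F e ∈ C := by
  have hunbounded (a : Set Ordinal.{u}) : ∃ x, a ⊆ x ∧ (a ∈ PK κ lam → x ∈ C) := by
    by_cases ha : a ∈ PK κ lam
    · obtain ⟨x, hx, hax⟩ := hC.unbounded a ha
      exact ⟨x, hax, fun _ => hx⟩
    · exact ⟨a, Subset.rfl, fun h => absurd h ha⟩
  choose c hc hcC using hunbounded
  let F : Finset Ordinal.{u} → Set Ordinal.{u} :=
    Finset.strongInduction fun e ih => c (↑e ∪ ⋃ (e') (h : e' ⊂ e), ih e' h)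
  have hF e : F e = c (↑e ∪ ⋃ e' ∈ {e' | e' ⊂ e}, F e') := Finset.strongInduction_eq _ e
  refine ⟨F, fun e' e he' => ?_, fun e => ?_, fun e => ?_⟩
  · rcases eq_or_ssubset_of_subset he' with rfl | hlt
    · exact le_rfl
    · rw [hF e]
      exact ((subset_biUnion_of_mem (u := F) hlt).trans subset_union_right).trans (hc _)
  · rw [hF]
    exact subset_union_left.trans (hc _)
  · induction e using Finset.strongInduction with | H e ih
    intro he
    have hfin : {e' | e' ⊂ e}.Finite :=
      e.powerset.finite_toSet.subset fun e' he' => Finset.mem_powerset.2 he'.1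
    rw [hF]
    exact hcC _ (union_mem_PK hκ₀ (finite_mem_PK hκ₀ e.finite_toSet he)
      (biUnion_mem_PK hκ (hfin.lt_aleph0.trans (aleph0_lt_lift hκ₀)) fun e' he' =>
        hC.subset_PK (ih e' he' ((Finset.coe_subset.2 he'.1).trans he))))

theorem exists_chain_filtration {α : Type v} {s : Set α} (hs : ℵ₀ ≤ #s) :
    ∃ 𝒮 : Set (Set α), #𝒮 ≤ #s ∧ IsChain (· ⊆ ·) 𝒮 ∧ (∀ t ∈ 𝒮, t ⊆ s ∧ #t < #s) ∧
      ∀ e : Finset α, ↑e ⊆ s → ∃ t ∈ 𝒮, ↑e ⊆ t := by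
  obtain ⟨r, hr, hlt⟩ := exists_injOn_lt_ord s
  let S : α → Set α := fun x => {z ∈ s | r z ≤ r x}
  refine ⟨S '' s, Cardinal.mk_image_le, ?_, ?_, fun e he => ?_⟩
  · rintro _ ⟨x, -, rfl⟩ _ ⟨z, -, rfl⟩ -
    exact (le_total (r x) (r z)).imp (fun h w hw => ⟨hw.1, hw.2.trans h⟩)
      fun h w hw => ⟨hw.1, hw.2.trans h⟩
  · rintro _ ⟨x, hx, rfl⟩
    refine ⟨fun z hz => hz.1, (mk_le_of_injOn_lt (hr.mono fun z hz => hz.1) fun z hz =>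
      Order.lt_succ_of_le hz.2).trans_lt (Cardinal.lt_ord.1 ?_)⟩
    exact (Cardinal.isSuccLimit_ord hs).succ_lt (hlt x hx)
  · obtain ⟨x, hx, hmax⟩ : ∃ x ∈ s, ∀ z ∈ e, r z ≤ r x := by
      rcases e.eq_empty_or_nonempty with rfl | hne
      · obtain ⟨x⟩ := Cardinal.mk_ne_zero_iff.1 (Cardinal.aleph0_pos.trans_le hs).ne'
        exact ⟨x, x.2, by simp⟩
      · obtain ⟨x, hx, hmax⟩ := e.exists_max_image r hne
        exact ⟨x, he hx, hmax⟩
    exact ⟨S x, mem_image_of_mem S hx, fun z hz => ⟨he hz, hmax z hz⟩⟩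

theorem IsClubIn.iUnion_finset_mem (hC : IsClubIn κ lam C)
    {F : Finset Ordinal.{u} → Set Ordinal.{u}} (hF : Monotone F)
    (hFC : ∀ e : Finset Ordinal.{u}, ↑e ⊆ Iio lam.ord → F e ∈ C) {s : Set Ordinal.{u}}
    (hs : s ∈ PK κ lam) : ⋃ e ∈ {e : Finset Ordinal.{u} | ↑e ⊆ s}, F e ∈ C := by
  let H : Set Ordinal.{u} → Set Ordinal.{u} := fun s =>
    ⋃ e ∈ {e : Finset Ordinal.{u} | ↑e ⊆ s}, F e
  have hH : Monotone H := fun a b hab => biUnion_subset_biUnion_left fun e he => he.trans hab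
  induction hc : #s using WellFoundedLT.induction generalizing s with | ind c ih
  subst hc
  rcases lt_or_ge #s ℵ₀ with hfin | hinf
  · lift s to Finset Ordinal.{u} using Cardinal.lt_aleph0_iff_set_finite.1 hfin
    have heq : H s = F s := Subset.antisymm
      (iUnion₂_subset fun e he => hF (Finset.coe_subset.1 he))
      (subset_biUnion_of_mem (u := F) (Subset.rfl : (s : Set Ordinal.{u}) ⊆ s))
    change H s ∈ C
    rw [heq]
    exact hFC s hs.1
  · obtain ⟨𝒮, hcard, hchain, hsmall, hcover⟩ := exists_chain_filtration hinf
    have hne : 𝒮.Nonempty := (hcover ∅ (by simp)).imp fun _ h => h.1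
    have heq : H s = ⋃₀ (H '' 𝒮) := by
      refine (iUnion₂_subset fun e he => ?_).antisymm (sUnion_subset ?_)
      · obtain ⟨t, ht, het⟩ := hcover e he
        exact (subset_biUnion_of_mem (u := F) het).trans
          (subset_sUnion_of_mem (mem_image_of_mem H ht))
      · exact forall_mem_image.2 fun t ht => hH (hsmall t ht).1
    change H s ∈ C
    rw [heq]
    exact hC.closed _ (image_subset_iff.2 fun t ht =>
        ih _ (hsmall t ht).2 (PK_mono hs (hsmall t ht).1) rfl)
      (hne.image H) (hchain.image_of_map_rel _ _ H fun _ _ h => hH h)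
      ((Cardinal.mk_image_le.trans hcard).trans_lt hs.2)

theorem nonstationary_eq_NSnormal (hκ : κ.IsRegular) (hκ₀ : ℵ₀ < κ) (hlam : κ ≤ lam) :
    nonstationary κ lam = NSnormal κ lam lam 2 := by
  refine Subset.antisymm ?_ (sInter_subset_of_mem (isNormalIdeal_nonstationary hκ hκ₀))
  rintro A ⟨hA, C, hC, hdisj⟩ J hJ
  obtain ⟨F, hF, hFsub, hFC⟩ := hC.exists_monotone_finset_map hκ hκ₀
  refine hJ.mem_of_subset (hJ.not_finset_closed_mem hκ₀ hlam le_rfl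
    fun e he => hC.subset_PK (hFC e he)) fun a ha => ⟨hA ha, ?_⟩
  by_contra! hclosed
  have heq : ⋃ e ∈ {e : Finset Ordinal.{u} | ↑e ⊆ a}, F e = a := by
    refine (iUnion₂_subset hclosed).antisymm fun ξ hξ => ?_
    have hξa : ↑({ξ} : Finset Ordinal.{u}) ⊆ a := by simpa using hξ
    exact mem_biUnion hξa (hFsub {ξ} (by simp))
  have haC := hC.iUnion_finset_mem hF hFC (hA ha)
  rw [heq] at haC
  exact notMem_empty a (hdisj ▸ ⟨ha, haC⟩)

theorem cofBar_le_of_subset_PK {τ : Cardinal.{u}} {I : Set (Set (Set Ordinal.{u}))}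
    (hκ₀ : ℵ₀ < κ) (hI : ∀ A ∈ I, A ⊆ PK κ τ) : cofBar κ I ≤
      Cardinal.lift.{u + 1} ((2 : Cardinal.{u}) ^ (2 : Cardinal.{u}) ^ τ) := by
  obtain ⟨Y, hY, -, hcard⟩ := exists_cofBar_eq hκ₀ I
  have hsub : Y ⊆ 𝒫 𝒫 (Iio τ.ord) := fun A hA a ha => (hI A (hY hA) ha).1
  rw [← hcard]
  refine (Cardinal.mk_le_mk_of_subset hsub).trans_eq ?_
  rw [Cardinal.mk_powerset, Cardinal.mk_powerset, Cardinal.mk_Iio_ordinal, card_ord]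
  simp only [Cardinal.lift_power, Cardinal.lift_two]

end Club

section Corollaries

variable {κ lam θ : Cardinal.{u}}

theorem powerlt_thetaBar_le (hlam : ℵ₀ ≤ lam) (hκlam : κ < lam) (hcf : κ ≤ lam.ord.cof)
    (hθκ : θ ≤ κ) (hpow : ∀ τ, κ ≤ τ → τ < lam → τ ^ lam.ord.cof < lam) :
    lam ^< thetaBar κ θ ≤ lam := by
  refine Cardinal.powerlt_le.2 fun c hc => ?_
  have hcκ : c < κ := hc.trans_le ((thetaBar_le κ θ).trans hθκ)
  have hc_cof : c < lam.ord.cof := hcκ.trans_le hcf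
  refine power_le_of_lt_cof hlam hc_cof fun τ hτ => ?_
  calc τ ^ c ≤ max κ τ ^ c := Cardinal.power_le_power_right (le_max_right _ _)
    _ ≤ max κ τ ^ lam.ord.cof := Cardinal.power_le_power_left
        (lt_max_of_lt_left hcκ.bot_lt).ne' hc_cof.le
    _ ≤ lam := (hpow _ (le_max_left _ _) (max_lt hκlam hτ)).le

theorem NSnormal_isNowherePrecipitous (hκ : κ.IsRegular) (hκ₀ : ℵ₀ < κ) (hlam : lam.IsSingular)
    (hcf : κ ≤ lam.ord.cof) (hθ : 2 ≤ θ) (hθκ : θ ≤ κ) (hex : ∃ J, IsNormalIdeal κ lam lam θ J)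
    (h : ∀ τ, κ ≤ τ → τ < lam → τ ^ lam.ord.cof < lam ∧
      cofBar κ (NSnormal κ τ τ θ) ≤ Cardinal.lift.{u + 1} (lam ^< thetaBar κ θ)) :
    IsNowherePrecipitous κ lam (NSnormal κ lam lam θ) := by
  have hκlam : κ < lam := hcf.trans_lt hlam.cof_ord_lt
  have h2 : 2 ^ lam.ord.cof < lam :=
    (Cardinal.power_le_power_right (hκ.nat_lt 2).le).trans_lt (h κ le_rfl hκlam).1
  have hpow := powerlt_thetaBar_le hlam.aleph0_le hκlam hcf hθκ fun τ hκτ hτ => (h τ hκτ hτ).1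
  refine proposition3p4_general hκ hκ₀ hcf h2 hθ (hθκ.trans_lt hκlam) hex fun τ hτ =>
    ⟨max κ τ, le_max_right _ _, max_lt hκlam hτ, ?_⟩
  exact (h _ (le_max_left _ _) (max_lt hκlam hτ)).2.trans (Cardinal.lift_le.2 hpow)

theorem nonstationary_isNowherePrecipitous (hκ : κ.IsRegular) (hκ₀ : ℵ₀ < κ)
    (hlam : lam.IsSingular) (hcf : κ ≤ lam.ord.cof) (hlim : lam.IsStrongLimit) :
    IsNowherePrecipitous κ lam (nonstationary κ lam) := by
  have hκlam : κ < lam := hcf.trans_lt hlam.cof_ord_lt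
  have hpow {τ : Cardinal.{u}} (hτ : τ < lam) : 2 ^ τ < lam := hlim.isStrongPrelimit hτ
  have hex τ : ∃ J, IsNormalIdeal κ τ τ 2 J := ⟨_, isNormalIdeal_nonstationary hκ hκ₀⟩
  rw [nonstationary_eq_NSnormal hκ hκ₀ hκlam.le]
  refine proposition3p4_general hκ hκ₀ hcf (hpow hlam.cof_ord_lt) le_rfl
    ((hκ.nat_lt 2).trans hκlam) (hex lam) fun τ hτ => ⟨τ, le_rfl, hτ, ?_⟩
  exact (cofBar_le_of_subset_PK hκ₀ (isLeast_NSnormal (hex τ)).1.subset_PK).trans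
    (Cardinal.lift_le.2 (hpow (hpow hτ)).le)

end Corollaries

end PKappaLambda

theorem proposition3p4 (κ lam : Cardinal.{u}) (hκ : κ.IsRegular) (hκ₀ : ℵ₀ < κ)
    (hlam : lam.IsSingular) (hcf : κ ≤ lam.ord.cof) :
    (∀ θ : Cardinal.{u}, 2 ≤ θ → θ ≤ κ →
      (∃ J, PKappaLambda.IsNormalIdeal κ lam lam θ J) →
      (∀ τ : Cardinal.{u}, κ ≤ τ → τ < lam →
        τ ^ lam.ord.cof < lam ∧
        PKappaLambda.cofBar κ (PKappaLambda.NSnormal κ τ τ θ) ≤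
          Cardinal.lift.{u + 1} (lam ^< PKappaLambda.thetaBar κ θ)) →
      PKappaLambda.IsNowherePrecipitous κ lam (PKappaLambda.NSnormal κ lam lam θ)) ∧
    (lam.IsStrongLimit →
      PKappaLambda.IsNowherePrecipitous κ lam (PKappaLambda.nonstationary κ lam)) :=
  ⟨fun _ hθ hθκ hex h =>
    PKappaLambda.NSnormal_isNowherePrecipitous hκ hκ₀ hlam hcf hθ hθκ hex h,
  PKappaLambda.nonstationary_isNowherePrecipitous hκ hκ₀ hlam hcf⟩
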